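/- Let $\Bbbk$ be a field and $(V,c)$ a finite-dimensional braided vector space with basis $x_1,\dots,x_n$, i.e. $c\in\mathrm{Aut}(V\otimes V)$ satisfies $(c\otimes\mathrm{id})(\mathrm{id}\otimes c)(c\otimes\mathrm{id})=(\mathrm{id}\otimes c)(c\otimes\mathrm{id})(\mathrm{id}\otimes c)$; write $c(x_i\otimes x_j)=\sum_{k,\ell}c_{ij}^{k\ell}x_k\otimes x_\ell$. Assume $c$ is rigid: the map $V^*\otimes V\to V\otimes V^*$, $f\otimes x\mapsto\sum_i(\mathrm{ev}\otimes\mathrm{id}\otimes\mathrm{id})(f\otimes c(x\otimes x_i)\otimes x_i^*)$, is invertible. Let $A=A(c)$ be the FRT bialgebra: the algebra generated by $t_i^j$ ($1\le i,j\le n$) with relations $\sum_{k,\ell}c_{ij}^{k\ell}t_k^rt_\ell^s=\sum_{k,\ell}t_i^kt_j^\ell c_{k\ell}^{rs}$, with $\Delta(t_i^j)=\sum_kt_i^k\otimes t_k^j$, $\varepsilon(t_i^j)=\delta_i^j$, coacting on $V$ by $\lambda(x_i)=\sum_jt_i^j\otimes x_j$. Here a coquasitriangular structure on a bialgebra is a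 convolution-invertible bilinear form $r$ with $r(ab,d)=r(a,d_{(1)})r(b,d_{(2)})$, $r(a,bd)=r(a_{(2)},b)r(a_{(1)},d)$ and $r(a_{(1)},b_{(1)})a_{(2)}b_{(2)}=b_{(1)}a_{(1)}r(a_{(2)},b_{(2)})$; $A$ carries the one determined by $r(t_i^k,t_j^\ell)=c_{ji}^{k\ell}$. Let $\mathfrak B=\bigoplus_{m\ge0}\mathfrak B^m$ be a weakly graded-Frobenius algebra for $A$ and $V$: a finite-dimensional $\mathbb N$-graded left $A$-comodule algebra with $\lambda(\mathfrak B^m)\subseteq A\otimes\mathfrak B^m$, $\mathfrak B^0=\Bbbk$, $\mathfrak B^1=V$ as comodules, $\dim\mathfrak B^{top}=1$ where $top=\max\{m:\mathfrak B^m\ne0\}$, and such that the multiplications $\mathfrak B^1\times\mathfrak B^{top-1}\to\mathfrak B^{top}$ and $\mathfrak B^{top-1}\times\mathfrak B^1\to\mathfrak B^{top}$ are non-degenerate. Let $0\ne\mathfrak b\in\mathfrak B^{top}$, let $D\in A$ be the group-like element with $\lambda(\mathfrak b)=D\otimes\mathfrak b$ (the quantum determinant), let $\omega^1,\dots,\omega^n\in\mathfrak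 B^{top-1}$ satisfy $x_i\omega^j=\delta_i^j\mathfrak b$, and define $T_i^j\in A$ by $\lambda(\omega^i)=\sum_jT_j^i\otimes\omega^j$. Put $\mathfrak J(a)=r(a_{(1)},D)\,a_{(2)}\,r^{-1}(a_{(3)},D)$ for $a\in A$. Let $H(c)=A[D^{-1}]$ be the algebra generated by the $t_i^j$ and $D^{-1}$ with the relations of $A$ and $DD^{-1}=1=D^{-1}D$; it is a bialgebra with $D^{-1}$ group-like. Let $\mathcal H(c)$ be the bialgebra generated by $\mathfrak t_i^j,\mathfrak u_i^j$ ($1\le i,j\le n$) with relations $\sum_{k,\ell}c_{ij}^{k\ell}\mathfrak t_k^r\mathfrak t_\ell^s=\sum_{k,\ell}\mathfrak t_i^k\mathfrak t_j^\ell c_{k\ell}^{rs}$ and $\sum_k\mathfrak u_i^k\mathfrak t_k^j=\delta_i^j=\sum_k\mathfrak t_i^k\mathfrak u_k^j$, with $\Delta(\mathfrak t_i^j)=\sum_k\mathfrak t_i^k\otimes\mathfrak t_k^j$, $\Delta(\mathfrak u_i^j)=\sum_k\mathfrak u_k^j\otimes\mathfrak u_i^k$, $\varepsilon(\mathfrak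 t_i^j)=\varepsilon(\mathfrak u_i^j)=\delta_i^j$, coacting on $V$ by $x_i\mapsto\sum_j\mathfrak t_i^j\otimes x_j$. Assume that in $A(c)$ $$\sum_{k=1}^n\mathfrak J(T_i^k)\,t_k^j=\delta_i^j\,D\qquad\text{for all }1\le i,j\le n.$$ Then $\mathcal H(c)$ and $H(c)$ are Hopf algebras, the antipode of $\mathcal H(c)$ sends $\mathfrak t_i^j$ to $\mathfrak u_i^j$, and there is an isomorphism of Hopf algebras $\mathcal H(c)\to H(c)$ with $\mathfrak t_i^j\mapsto t_i^j$ and $\mathfrak u_i^j\mapsto T_i^jD^{-1}$ for all $i,j$. Moreover $\mathcal H(c)$ is the universal coquasitriangular Hopf algebra of $(V,c)$: it has a coquasitriangular structure $r$ for which $v\otimes w\mapsto r(w_{(-1)},v_{(-1)})\,w_{(0)}\otimes v_{(0)}$ is $c$, and for every coquasitriangular Hopf algebra $(L,r')$ with a left coaction $\lambda'$ on $V$ inducing $c$ in the same way there is a unique bialgebra map $f:\mathcal H(c)\to L$ with $\lambda'=(f\otimes\mathrm{id})\lambda$, and it satisfies $r'\circ(f\otimes f)=r$. -/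

import Mathlib

open scoped TensorProduct

universe u v w z

noncomputable section

/-! ### General notions: antipodes, left coactions, coquasitriangular structures -/

section General

variable {k : Type u} [Field k]

/-- `S` is an antipode of the bialgebra `K`. -/
def IsAntipode {K : Type v} [Ring K] [Bialgebra k K] (S : K →ₗ[k] K) : Prop :=
  LinearMap.mul' k K ∘ₗ TensorProduct.map S LinearMap.id ∘ₗ Coalgebra.comul =
      Algebra.linearMap k K ∘ₗ Coalgebra.counit ∧
    LinearMap.mul' k K ∘ₗ TensorProduct.map LinearMap.id S ∘ₗ Coalgebra.comul =
      Algebra.linearMap k K ∘ₗ Coalgebra.counit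

/-- `ρ` is a (counital, coassociative) left coaction of the bialgebra `K` on the space `M`. -/
structure IsLeftCoaction {K : Type v} [Ring K] [Bialgebra k K] {M : Type w} [AddCommGroup M]
    [Module k M] (ρ : M →ₗ[k] K ⊗[k] M) : Prop where
  coassoc : ∀ m, TensorProduct.assoc k K K M
      (TensorProduct.map Coalgebra.comul LinearMap.id (ρ m)) =
    TensorProduct.map LinearMap.id ρ (ρ m)
  counit : ∀ m, TensorProduct.lid k M
      (TensorProduct.map Coalgebra.counit LinearMap.id (ρ m)) = m

/-- `R' : K ⊗ K → k` is a two-sided convolution inverse of `R : K ⊗ K → k`. -/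
def IsConvInverse {K : Type v} [Ring K] [Bialgebra k K] (R R' : K ⊗[k] K →ₗ[k] k) : Prop :=
  LinearMap.mul' k k ∘ₗ TensorProduct.map R R' ∘ₗ Coalgebra.comul = Coalgebra.counit ∧
    LinearMap.mul' k k ∘ₗ TensorProduct.map R' R ∘ₗ Coalgebra.comul = Coalgebra.counit

/-- `R` is a coquasitriangular structure on the bialgebra `K`: writing `r(a,b) = R (a ⊗ b)`, the
form `r` is convolution invertible and
* `r(ab,c) = r(a,c₁) r(b,c₂)`,
* `r(a,bc) = r(a₁,c) r(a₂,b)`,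
* `r(a₁,b₁) a₂ b₂ = b₁ a₁ r(a₂,b₂)`. -/
structure IsCoquasitriangular {K : Type v} [Ring K] [Bialgebra k K]
    (R : K ⊗[k] K →ₗ[k] k) : Prop where
  inv : ∃ R' : K ⊗[k] K →ₗ[k] k, IsConvInverse R R'
  mul_left : ∀ a b c : K, R ((a * b) ⊗ₜ c) =
    LinearMap.mul' k k (TensorProduct.map (TensorProduct.curry R a) (TensorProduct.curry R b)
      (Coalgebra.comul c))
  mul_right : ∀ a b c : K, R (a ⊗ₜ (b * c)) =
    LinearMap.mul' k k (TensorProduct.map ((TensorProduct.curry R).flip c)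
      ((TensorProduct.curry R).flip b) (Coalgebra.comul a))
  comm : ∀ a b : K,
    TensorProduct.lid k K (TensorProduct.map R (LinearMap.mul' k K)
      (Coalgebra.comul (R := k) (a ⊗ₜ[k] b))) =
    TensorProduct.rid k K (TensorProduct.map
      (LinearMap.mul' k K ∘ₗ (TensorProduct.comm k K K).toLinearMap) R
      (Coalgebra.comul (R := k) (a ⊗ₜ[k] b)))

/-- The map `v ⊗ w ↦ r(w₍₋₁₎, v₍₋₁₎) w₍₀₎ ⊗ v₍₀₎` on `V ⊗ V` given by a form `r` on `K` and a
`K`-coaction on `V`. -/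
def inducedBraiding {K : Type v} [Ring K] [Bialgebra k K] {V : Type w} [AddCommGroup V]
    [Module k V] (R : K ⊗[k] K →ₗ[k] k) (ρ : V →ₗ[k] K ⊗[k] V) :
    V ⊗[k] V →ₗ[k] V ⊗[k] V :=
  (TensorProduct.lid k (V ⊗[k] V)).toLinearMap ∘ₗ TensorProduct.map R LinearMap.id ∘ₗ
    (TensorProduct.tensorTensorTensorComm k K V K V).toLinearMap ∘ₗ
    TensorProduct.map ρ ρ ∘ₗ (TensorProduct.comm k V V).toLinearMap

/-- `(K, R)`, coacting on `V` by `ρ`, is a universal coquasitriangular Hopf algebra of the braided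
vector space `(V, c)`: it is a coquasitriangular Hopf algebra whose induced braiding on `V` is `c`,
and for every other such `(L, R', ρ')` there is a unique bialgebra map `f : K → L` compatible with
the coactions, and this map is compatible with the coquasitriangular structures. -/
structure IsUniversalCQTHopf.{u₁, v₁, w₁, w₂} {k : Type u₁} [Field k] {V : Type v₁}
    [AddCommGroup V] [Module k V]
    (c : V ⊗[k] V →ₗ[k] V ⊗[k] V) {K : Type w₁} [Ring K] [Bialgebra k K]
    (R : K ⊗[k] K →ₗ[k] k) (ρ : V →ₗ[k] K ⊗[k] V) : Prop where
  hopf : ∃ S : K →ₗ[k] K, IsAntipode S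
  cqt : IsCoquasitriangular R
  coaction : IsLeftCoaction ρ
  braiding : inducedBraiding R ρ = c
  universal : ∀ (L : Type w₂) [Ring L] [HopfAlgebra k L] (R' : L ⊗[k] L →ₗ[k] k)
    (ρ' : V →ₗ[k] L ⊗[k] V), IsCoquasitriangular R' → IsLeftCoaction ρ' →
    inducedBraiding R' ρ' = c →
    ∃ f : K →ₐc[k] L,
      ρ' = TensorProduct.map (f : K →ₗ[k] L) LinearMap.id ∘ₗ ρ ∧
      R' ∘ₗ TensorProduct.map (f : K →ₗ[k] L) (f : K →ₗ[k] L) = R ∧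
      ∀ g : K →ₐc[k] L,
        ρ' = TensorProduct.map (g : K →ₗ[k] L) LinearMap.id ∘ₗ ρ → g = f

/-- For a form `R` with convolution inverse `R'` and an element `g`, the map
`a ↦ r(a₁,g) a₂ r⁻¹(a₃,g)`. -/
def conjBy {K : Type v} [Ring K] [Bialgebra k K] (R R' : K ⊗[k] K →ₗ[k] k) (g : K) :
    K →ₗ[k] K :=
  (TensorProduct.lid k K).toLinearMap ∘ₗ
    TensorProduct.map ((TensorProduct.curry R).flip g)
      ((TensorProduct.rid k K).toLinearMap ∘ₗ
        TensorProduct.map LinearMap.id ((TensorProduct.curry R').flip g) ∘ₗ Coalgebra.comul) ∘ₗ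
    Coalgebra.comul

end General

/-! ### Braided vector spaces -/

section Braided

variable {k : Type u} [Field k] {V : Type v} [AddCommGroup V] [Module k V]

/-- The braid equation `(c ⊗ id)(id ⊗ c)(c ⊗ id) = (id ⊗ c)(c ⊗ id)(id ⊗ c)`. -/
def IsBraiding (c : V ⊗[k] V ≃ₗ[k] V ⊗[k] V) : Prop :=
  let c₁ : (V ⊗[k] V) ⊗[k] V →ₗ[k] (V ⊗[k] V) ⊗[k] V :=
    TensorProduct.map c.toLinearMap LinearMap.id
  let c₂ : (V ⊗[k] V) ⊗[k] V →ₗ[k] (V ⊗[k] V) ⊗[k] V :=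
    (TensorProduct.assoc k V V V).symm.toLinearMap ∘ₗ
      TensorProduct.map LinearMap.id c.toLinearMap ∘ₗ (TensorProduct.assoc k V V V).toLinearMap
  c₁ ∘ₗ c₂ ∘ₗ c₁ = c₂ ∘ₗ c₁ ∘ₗ c₂

variable {n : ℕ}

/-- The map `c♭ : V* ⊗ V → V ⊗ V*`,
`c♭(f ⊗ v) = ∑ᵢ (ev ⊗ id ⊗ id)(f ⊗ c(v ⊗ xᵢ) ⊗ xᵢ*)`. -/
def flat (x : Module.Basis (Fin n) k V) (c : V ⊗[k] V ≃ₗ[k] V ⊗[k] V) :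
    Module.Dual k V ⊗[k] V →ₗ[k] V ⊗[k] Module.Dual k V :=
  TensorProduct.lift (LinearMap.mk₂ k
    (fun f v => ∑ i, (TensorProduct.lid k V (TensorProduct.map f LinearMap.id (c (v ⊗ₜ x i))))
      ⊗ₜ[k] x.coord i)
    (fun f g v => by
      simp [TensorProduct.map_add_left, TensorProduct.add_tmul, Finset.sum_add_distrib])
    (fun a f v => by
      simp [TensorProduct.map_smul_left, TensorProduct.smul_tmul', Finset.smul_sum])
    (fun f v v' => by simp [TensorProduct.add_tmul, Finset.sum_add_distrib])
    (fun a f v => by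
      simp [← TensorProduct.smul_tmul', Finset.smul_sum]))

/-- The braiding `c` is rigid if `c♭` is invertible. -/
def IsRigid (x : Module.Basis (Fin n) k V) (c : V ⊗[k] V ≃ₗ[k] V ⊗[k] V) : Prop :=
  Function.Bijective (flat x c)

/-- The coefficients `c_{ij}^{kl}`, with `c(xᵢ ⊗ xⱼ) = ∑ₖₗ c_{ij}^{kl} xₖ ⊗ xₗ`. -/
def coeff (x : Module.Basis (Fin n) k V) (c : V ⊗[k] V ≃ₗ[k] V ⊗[k] V)
    (i j a b : Fin n) : k :=
  (x.tensorProduct x).repr (c (x i ⊗ₜ x j)) (a, b)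

end Braided

/-! ### The FRT bialgebra -/

section FRT

variable {k : Type u} [Field k] {n : ℕ} (C : Fin n → Fin n → Fin n → Fin n → k)

/-- The relations `∑ c_{ij}^{kl} t_k^r t_l^s = ∑ t_i^k t_j^l c_{kl}^{rs}`; the generator
`t_i^j` is indexed by `(i, j)`. -/
inductive FRTRel : FreeAlgebra k (Fin n × Fin n) → FreeAlgebra k (Fin n × Fin n) → Prop
  | frt (i j r s : Fin n) : FRTRel
      (∑ a, ∑ b, C i j a b • (FreeAlgebra.ι k (a, r) * FreeAlgebra.ι k (b, s)))
      (∑ a, ∑ b, C a b r s • (FreeAlgebra.ι k (i, a) * FreeAlgebra.ι k (j, b)))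

/-- The FRT algebra `A(c)`. -/
def FRT : Type u := RingQuot (FRTRel C)

namespace FRT

instance : Ring (FRT C) := inferInstanceAs (Ring (RingQuot (FRTRel C)))
instance : Algebra k (FRT C) := inferInstanceAs (Algebra k (RingQuot (FRTRel C)))

/-! Shortcut instances. -/

instance : Semiring (FRT C) := inferInstance
instance : AddCommMonoid (FRT C) := inferInstance
instance : Module k (FRT C) := inferInstance
instance : Semiring (FRT C ⊗[k] FRT C) := inferInstance
instance : AddCommMonoid (FRT C ⊗[k] FRT C) := inferInstance
instance : Module k (FRT C ⊗[k] FRT C) := inferInstance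

/-- The quotient map from the free algebra. -/
def mk : FreeAlgebra k (Fin n × Fin n) →ₐ[k] FRT C := RingQuot.mkAlgHom k (FRTRel C)

/-- The generators `t_i^j`. -/
def t (i j : Fin n) : FRT C := mk C (FreeAlgebra.ι k (i, j))

variable {C}

theorem t_rel (i j r s : Fin n) :
    ∑ a, ∑ b, C i j a b • (t C a r * t C b s) = ∑ a, ∑ b, C a b r s • (t C i a * t C j b) := by
  have h : mk C _ = mk C _ := RingQuot.mkAlgHom_rel k (FRTRel.frt (C := C) i j r s)
  simpa [t] using h

/-- The universal property of `A(c)` as an algebra. -/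
def lift {B : Type w} [Semiring B] [Algebra k B] (f : Fin n → Fin n → B)
    (hf : ∀ i j r s, ∑ a, ∑ b, C i j a b • (f a r * f b s) =
      ∑ a, ∑ b, C a b r s • (f i a * f j b)) : FRT C →ₐ[k] B :=
  RingQuot.liftAlgHom k ⟨FreeAlgebra.lift k (fun p => f p.1 p.2), by
    rintro _ _ ⟨i, j, r, s⟩
    simpa using hf i j r s⟩

@[simp] theorem lift_t {B : Type w} [Semiring B] [Algebra k B] (f : Fin n → Fin n → B)
    (hf : ∀ i j r s, ∑ a, ∑ b, C i j a b • (f a r * f b s) =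
      ∑ a, ∑ b, C a b r s • (f i a * f j b)) (i j : Fin n) : lift f hf (t C i j) = f i j := by
  simp only [lift, t, mk]
  erw [RingQuot.liftAlgHom_mkAlgHom_apply]
  simp

theorem algHom_ext {B : Type w} [Semiring B] [Algebra k B] {f g : FRT C →ₐ[k] B}
    (h : ∀ i j, f (t C i j) = g (t C i j)) : f = g := by
  refine RingQuot.ringQuot_ext' k f g ?_
  ext p
  exact h p.1 p.2

theorem comul_rel {B : Type w} [Semiring B] [Algebra k B] (f g : Fin n → Fin n → B)
    (hf : ∀ i j r s, ∑ a, ∑ b, C i j a b • (f a r * f b s) =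
      ∑ a, ∑ b, C a b r s • (f i a * f j b))
    (hg : ∀ i j r s, ∑ a, ∑ b, C i j a b • (g a r * g b s) =
      ∑ a, ∑ b, C a b r s • (g i a * g j b)) (i j r s : Fin n) :
    ∑ a, ∑ b, C i j a b • ((∑ p, f a p ⊗ₜ[k] g p r) * (∑ q, f b q ⊗ₜ[k] g q s)) =
      ∑ a, ∑ b, C a b r s • ((∑ p, f i p ⊗ₜ[k] g p a) * (∑ q, f j q ⊗ₜ[k] g q b)) := by
  have e1 : ∀ a b, C i j a b • ((∑ p, f a p ⊗ₜ[k] g p r) * (∑ q, f b q ⊗ₜ[k] g q s)) =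
      ∑ p, ∑ q, (C i j a b • (f a p * f b q)) ⊗ₜ[k] (g p r * g q s) := by
    intro a b
    simp only [Finset.sum_mul_sum, Finset.smul_sum, Algebra.TensorProduct.tmul_mul_tmul,
      TensorProduct.smul_tmul']
  have e2 : ∀ a b, C a b r s • ((∑ p, f i p ⊗ₜ[k] g p a) * (∑ q, f j q ⊗ₜ[k] g q b)) =
      ∑ p, ∑ q, (f i p * f j q) ⊗ₜ[k] (C a b r s • (g p a * g q b)) := by
    intro a b
    simp only [Finset.sum_mul_sum, Finset.smul_sum, Algebra.TensorProduct.tmul_mul_tmul,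
      TensorProduct.tmul_smul]
  have sw : ∀ F : Fin n → Fin n → Fin n → Fin n → B ⊗[k] B,
      ∑ a, ∑ b, ∑ p, ∑ q, F a b p q = ∑ p, ∑ q, ∑ a, ∑ b, F a b p q := by
    intro F
    have := Finset.sum_comm (s := (Finset.univ : Finset (Fin n × Fin n)))
      (t := (Finset.univ : Finset (Fin n × Fin n))) (f := fun x y => F x.1 x.2 y.1 y.2)
    simpa only [Fintype.sum_prod_type] using this
  simp only [e1, e2]
  have m : ∀ p q, ∑ a, ∑ b, (C i j a b • (f a p * f b q)) ⊗ₜ[k] (g p r * g q s) =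
      ∑ a, ∑ b, (f i a * f j b) ⊗ₜ[k] (C a b p q • (g p r * g q s)) := by
    intro p q
    simp only [← TensorProduct.sum_tmul, hf, TensorProduct.tmul_smul, TensorProduct.smul_tmul']
  have m2 : ∀ p q, ∑ a, ∑ b, (f i p * f j q) ⊗ₜ[k] (C a b r s • (g p a * g q b)) =
      ∑ a, ∑ b, (f i p * f j q) ⊗ₜ[k] (C p q a b • (g a r * g b s)) := by
    intro p q
    simp only [← TensorProduct.tmul_sum, hg]
  refine (sw fun a b p q => (C i j a b • (f a p * f b q)) ⊗ₜ[k] (g p r * g q s)).trans ?_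
  refine Eq.trans ?_
    (sw fun a b p q => (f i p * f j q) ⊗ₜ[k] (C a b r s • (g p a * g q b))).symm
  simp only [m, m2]
  exact sw fun p q a b => (f i a * f j b) ⊗ₜ[k] (C a b p q • (g p r * g q s))

theorem counit_rel (i j r s : Fin n) :
    ∑ a, ∑ b, C i j a b • ((if a = r then (1 : k) else 0) * (if b = s then 1 else 0)) =
      ∑ a, ∑ b, C a b r s • ((if i = a then (1 : k) else 0) * (if j = b then 1 else 0)) := by
  simp

/-- `A(c)` is a bialgebra, with `Δ(t_i^j) = ∑ₖ t_i^k ⊗ t_k^j` and `ε(t_i^j) = δ_{ij}`. -/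
instance : Bialgebra k (FRT C) :=
  Bialgebra.ofAlgHom
    (lift (fun i j => ∑ a, t C i a ⊗ₜ[k] t C a j) (comul_rel _ _ t_rel t_rel))
    (lift (fun i j => if i = j then 1 else 0) counit_rel)
    (algHom_ext fun i j => by
      simp [TensorProduct.sum_tmul, TensorProduct.tmul_sum]
      exact Finset.sum_comm)
    (algHom_ext fun i j => by simp [TensorProduct.ite_tmul])
    (algHom_ext fun i j => by simp [TensorProduct.tmul_ite])

instance : Coalgebra k (FRT C) := inferInstance
instance : CoalgebraStruct k (FRT C) := inferInstance

@[simp] theorem comul_t (i j : Fin n) :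
    Coalgebra.comul (R := k) (t C i j) = ∑ a, t C i a ⊗ₜ[k] t C a j :=
  lift_t (C := C) _ _ i j

@[simp] theorem counit_t (i j : Fin n) :
    Coalgebra.counit (R := k) (t C i j) = if i = j then 1 else 0 :=
  lift_t (C := C) _ _ i j

end FRT

end FRT

/-! ### Localization of `A(c)` at a group-like element -/

section Localization

variable {k : Type u} [Field k] {n : ℕ} {C : Fin n → Fin n → Fin n → Fin n → k}

/-- The relations of the algebra generated by the `t_i^j` (indexed by `some (i, j)`) and `D⁻¹`
(indexed by `none`): the relations of `A(c)`, and `D D⁻¹ = 1 = D⁻¹ D` for every noncommutative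
polynomial in the `t_i^j` that represents `D`. -/
inductive LocRel (D : FRT C) : FreeAlgebra k (Option (Fin n × Fin n)) →
    FreeAlgebra k (Option (Fin n × Fin n)) → Prop
  | frt (i j r s : Fin n) : LocRel D
      (∑ a, ∑ b, C i j a b •
        (FreeAlgebra.ι k (some (a, r)) * FreeAlgebra.ι k (some (b, s))))
      (∑ a, ∑ b, C a b r s •
        (FreeAlgebra.ι k (some (i, a)) * FreeAlgebra.ι k (some (j, b))))
  | mul_inv (p : FreeAlgebra k (Fin n × Fin n)) (hp : FRT.mk C p = D) : LocRel D
      (FreeAlgebra.lift k (fun q => FreeAlgebra.ι k (some q)) p * FreeAlgebra.ι k none) 1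
  | inv_mul (p : FreeAlgebra k (Fin n × Fin n)) (hp : FRT.mk C p = D) : LocRel D
      (FreeAlgebra.ι k none * FreeAlgebra.lift k (fun q => FreeAlgebra.ι k (some q)) p) 1

/-- The localization `A(c)[D⁻¹]` at a group-like element `D`. -/
def Loc (D : GroupLike k (FRT C)) : Type u := RingQuot (LocRel D.val)

namespace Loc

variable (D : GroupLike k (FRT C))

instance : Ring (Loc D) := inferInstanceAs (Ring (RingQuot (LocRel D.val)))
instance : Algebra k (Loc D) := inferInstanceAs (Algebra k (RingQuot (LocRel D.val)))

/-- The quotient map from the free algebra. -/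
def mk : FreeAlgebra k (Option (Fin n × Fin n)) →ₐ[k] Loc D :=
  RingQuot.mkAlgHom k (LocRel D.val)

/-- The canonical map `A(c) → A(c)[D⁻¹]`. -/
def ι : FRT C →ₐ[k] Loc D :=
  FRT.lift (fun i j => mk D (FreeAlgebra.ι k (some (i, j)))) (fun i j r s => by
    have h : mk D _ = mk D _ := RingQuot.mkAlgHom_rel k (LocRel.frt (D := D.val) i j r s)
    simpa using h)

/-- The element `D⁻¹`. -/
def inv : Loc D := mk D (FreeAlgebra.ι k none)

theorem ι_mk (p : FreeAlgebra k (Fin n × Fin n)) : ι D (FRT.mk C p) =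
    mk D (FreeAlgebra.lift k (fun q => FreeAlgebra.ι k (some q)) p) := by
  have : (ι D).comp (FRT.mk C) =
      (mk D).comp (FreeAlgebra.lift k (fun q => FreeAlgebra.ι k (some q))) := by
    ext q
    simp only [Function.comp_apply, AlgHom.coe_comp, FreeAlgebra.lift_ι_apply]
    exact FRT.lift_t (C := C) _ _ q.1 q.2
  exact DFunLike.congr_fun this p

theorem ι_mul_inv : ι D D.val * inv D = 1 := by
  obtain ⟨p, hp⟩ := RingQuot.mkAlgHom_surjective k (FRTRel C) D.val
  have h : mk D _ = mk D _ := RingQuot.mkAlgHom_rel k (LocRel.mul_inv (D := D.val) p hp)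
  rw [map_mul, ← ι_mk, map_one] at h
  exact (congrArg (fun z => ι D z * inv D) hp.symm).trans h

theorem inv_mul_ι : inv D * ι D D.val = 1 := by
  obtain ⟨p, hp⟩ := RingQuot.mkAlgHom_surjective k (FRTRel C) D.val
  have h : mk D _ = mk D _ := RingQuot.mkAlgHom_rel k (LocRel.inv_mul (D := D.val) p hp)
  rw [map_mul, ← ι_mk, map_one] at h
  exact (congrArg (fun z => inv D * ι D z) hp.symm).trans h

variable {D}

/-- The universal property of the localization. -/
def lift {B : Type w} [Semiring B] [Algebra k B] (f : FRT C →ₐ[k] B) (b : B)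
    (h₁ : f D.val * b = 1) (h₂ : b * f D.val = 1) : Loc D →ₐ[k] B :=
  RingQuot.liftAlgHom k ⟨FreeAlgebra.lift k
      (fun o => o.elim b (fun q => f (FRT.t C q.1 q.2))), by
    have key : ∀ p : FreeAlgebra k (Fin n × Fin n),
        FreeAlgebra.lift k (fun o : Option (Fin n × Fin n) =>
            o.elim b (fun q => f (FRT.t C q.1 q.2)))
          (FreeAlgebra.lift k (fun q => FreeAlgebra.ι k (some q)) p) = f (FRT.mk C p) := by
      intro p
      have : (FreeAlgebra.lift k (fun o : Option (Fin n × Fin n) =>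
            o.elim b (fun q => f (FRT.t C q.1 q.2)))).comp
          (FreeAlgebra.lift k (fun q => FreeAlgebra.ι k (some q))) = f.comp (FRT.mk C) := by
        ext q
        simp [FRT.t]
      exact DFunLike.congr_fun this p
    rintro _ _ (⟨i, j, r, s⟩ | ⟨p, hp⟩ | ⟨p, hp⟩)
    · have := congrArg f (FRT.t_rel (C := C) i j r s)
      simpa using this
    · simp [key, hp, h₁]
    · simp [key, hp, h₂]⟩

@[simp] theorem lift_ι {B : Type w} [Semiring B] [Algebra k B] (f : FRT C →ₐ[k] B) (b : B)
    (h₁ : f D.val * b = 1) (h₂ : b * f D.val = 1) (a : FRT C) :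
    lift f b h₁ h₂ (ι D a) = f a := by
  have : (lift f b h₁ h₂).comp (ι D) = f := by
    refine FRT.algHom_ext fun i j => ?_
    simp only [AlgHom.comp_apply, ι, FRT.lift_t]
    simp only [lift, mk]
    erw [RingQuot.liftAlgHom_mkAlgHom_apply]
    simp
  exact DFunLike.congr_fun this a

@[simp] theorem lift_inv {B : Type w} [Semiring B] [Algebra k B] (f : FRT C →ₐ[k] B) (b : B)
    (h₁ : f D.val * b = 1) (h₂ : b * f D.val = 1) : lift f b h₁ h₂ (inv D) = b := by
  simp only [lift, inv, mk]
  erw [RingQuot.liftAlgHom_mkAlgHom_apply]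
  simp

theorem algHom_ext {B : Type w} [Semiring B] [Algebra k B] {f g : Loc D →ₐ[k] B}
    (h : ∀ i j, f (ι D (FRT.t C i j)) = g (ι D (FRT.t C i j))) (h' : f (inv D) = g (inv D)) :
    f = g := by
  refine RingQuot.ringQuot_ext' k f g ?_
  ext o
  rcases o with _ | q
  · exact h'
  · have := h q.1 q.2
    simp only [ι, FRT.lift_t] at this
    exact this

/-- `A(c)[D⁻¹]` is a bialgebra: the coalgebra structure of `A(c)` extended by
`Δ(D⁻¹) = D⁻¹ ⊗ D⁻¹` and `ε(D⁻¹) = 1`. -/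
instance : Bialgebra k (Loc D) :=
  Bialgebra.ofAlgHom
    (lift ((Algebra.TensorProduct.map (ι D) (ι D)).comp (Bialgebra.comulAlgHom k (FRT C)))
      (inv D ⊗ₜ[k] inv D)
      (by simp [D.isGroupLikeElem_val.comul_eq_tmul_self, ι_mul_inv,
        Algebra.TensorProduct.one_def])
      (by simp [D.isGroupLikeElem_val.comul_eq_tmul_self, inv_mul_ι,
        Algebra.TensorProduct.one_def]))
    (lift (Bialgebra.counitAlgHom k (FRT C)) 1
      (by simp [D.isGroupLikeElem_val.counit_eq_one])
      (by simp [D.isGroupLikeElem_val.counit_eq_one]))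
    (algHom_ext
      (fun i j => by
        simp [TensorProduct.sum_tmul, TensorProduct.tmul_sum]
        exact Finset.sum_comm)
      (by simp))
    (algHom_ext (fun i j => by simp [TensorProduct.ite_tmul]) (by simp))
    (algHom_ext (fun i j => by simp [TensorProduct.tmul_ite]) (by simp))

@[simp] theorem comul_ι (a : FRT C) : Coalgebra.comul (R := k) (ι D a) =
    TensorProduct.map (ι D).toLinearMap (ι D).toLinearMap (Coalgebra.comul a) :=
  lift_ι (D := D) _ _ _ _ a

@[simp] theorem counit_ι (a : FRT C) :
    Coalgebra.counit (R := k) (ι D a) = Coalgebra.counit (R := k) a :=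
  lift_ι (D := D) _ _ _ _ a

@[simp] theorem comul_inv : Coalgebra.comul (R := k) (inv D) = inv D ⊗ₜ[k] inv D :=
  lift_inv (D := D) _ _ _ _

@[simp] theorem counit_inv : Coalgebra.counit (R := k) (inv D) = 1 :=
  lift_inv (D := D) _ _ _ _

end Loc

end Localization

/-! ### The bialgebra generated by the entries of a matrix `t` and of its inverse `u` -/

section Schauenburg

variable {k : Type u} [Field k] {n : ℕ} (C : Fin n → Fin n → Fin n → Fin n → k)

/-- The relations `∑ c_{ij}^{kl} t_k^r t_l^s = ∑ t_i^k t_j^l c_{kl}^{rs}` and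
`∑ u_i^k t_k^j = δ_i^j = ∑ t_i^k u_k^j`; `t_i^j` and `u_i^j` are indexed by
`Sum.inl (i, j)` and `Sum.inr (i, j)`. -/
inductive SchauenburgRel : FreeAlgebra k ((Fin n × Fin n) ⊕ (Fin n × Fin n)) →
    FreeAlgebra k ((Fin n × Fin n) ⊕ (Fin n × Fin n)) → Prop
  | frt (i j r s : Fin n) : SchauenburgRel
      (∑ a, ∑ b, C i j a b •
        (FreeAlgebra.ι k (Sum.inl (a, r)) * FreeAlgebra.ι k (Sum.inl (b, s))))
      (∑ a, ∑ b, C a b r s •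
        (FreeAlgebra.ι k (Sum.inl (i, a)) * FreeAlgebra.ι k (Sum.inl (j, b))))
  | u_mul_t (i j : Fin n) : SchauenburgRel
      (∑ a, FreeAlgebra.ι k (Sum.inr (i, a)) * FreeAlgebra.ι k (Sum.inl (a, j)))
      (if i = j then 1 else 0)
  | t_mul_u (i j : Fin n) : SchauenburgRel
      (∑ a, FreeAlgebra.ι k (Sum.inl (i, a)) * FreeAlgebra.ι k (Sum.inr (a, j)))
      (if i = j then 1 else 0)

/-- The algebra `𝓗(c)`. -/
def Schauenburg : Type u := RingQuot (SchauenburgRel C)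

namespace Schauenburg

instance : Ring (Schauenburg C) := inferInstanceAs (Ring (RingQuot (SchauenburgRel C)))
instance : Algebra k (Schauenburg C) :=
  inferInstanceAs (Algebra k (RingQuot (SchauenburgRel C)))

/-- The quotient map from the free algebra. -/
def mk : FreeAlgebra k ((Fin n × Fin n) ⊕ (Fin n × Fin n)) →ₐ[k] Schauenburg C :=
  RingQuot.mkAlgHom k (SchauenburgRel C)

/-- The generators `t_i^j` of `𝓗(c)`. -/
def t (i j : Fin n) : Schauenburg C := mk C (FreeAlgebra.ι k (Sum.inl (i, j)))

/-- The generators `u_i^j` of `𝓗(c)`. -/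
def u (i j : Fin n) : Schauenburg C := mk C (FreeAlgebra.ι k (Sum.inr (i, j)))

variable {C}

theorem t_rel (i j r s : Fin n) :
    ∑ a, ∑ b, C i j a b • (t C a r * t C b s) = ∑ a, ∑ b, C a b r s • (t C i a * t C j b) := by
  have h : mk C _ = mk C _ := RingQuot.mkAlgHom_rel k (SchauenburgRel.frt (C := C) i j r s)
  simpa [t] using h

theorem u_mul_t (i j : Fin n) : ∑ a, u C i a * t C a j = if i = j then 1 else 0 := by
  have h : mk C _ = mk C _ := RingQuot.mkAlgHom_rel k (SchauenburgRel.u_mul_t (C := C) i j)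
  simpa [t, u, apply_ite (mk C)] using h

theorem t_mul_u (i j : Fin n) : ∑ a, t C i a * u C a j = if i = j then 1 else 0 := by
  have h : mk C _ = mk C _ := RingQuot.mkAlgHom_rel k (SchauenburgRel.t_mul_u (C := C) i j)
  simpa [t, u, apply_ite (mk C)] using h

/-- The universal property of `𝓗(c)` as an algebra. -/
def lift {B : Type w} [Semiring B] [Algebra k B] (f g : Fin n → Fin n → B)
    (hf : ∀ i j r s, ∑ a, ∑ b, C i j a b • (f a r * f b s) =
      ∑ a, ∑ b, C a b r s • (f i a * f j b))
    (hgf : ∀ i j, ∑ a, g i a * f a j = if i = j then 1 else 0)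
    (hfg : ∀ i j, ∑ a, f i a * g a j = if i = j then 1 else 0) : Schauenburg C →ₐ[k] B :=
  RingQuot.liftAlgHom k ⟨FreeAlgebra.lift k
      (Sum.elim (fun p => f p.1 p.2) (fun p => g p.1 p.2)), by
    rintro _ _ (⟨i, j, r, s⟩ | ⟨i, j⟩ | ⟨i, j⟩)
    · simpa using hf i j r s
    · simpa [apply_ite (FreeAlgebra.lift k _)] using hgf i j
    · simpa [apply_ite (FreeAlgebra.lift k _)] using hfg i j⟩

section

variable {B : Type w} [Semiring B] [Algebra k B] (f g : Fin n → Fin n → B)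
    (hf : ∀ i j r s, ∑ a, ∑ b, C i j a b • (f a r * f b s) =
      ∑ a, ∑ b, C a b r s • (f i a * f j b))
    (hgf : ∀ i j, ∑ a, g i a * f a j = if i = j then 1 else 0)
    (hfg : ∀ i j, ∑ a, f i a * g a j = if i = j then 1 else 0)

@[simp] theorem lift_t (i j : Fin n) : lift f g hf hgf hfg (t C i j) = f i j := by
  simp only [lift, t, mk]
  erw [RingQuot.liftAlgHom_mkAlgHom_apply]
  simp

@[simp] theorem lift_u (i j : Fin n) : lift f g hf hgf hfg (u C i j) = g i j := by
  simp only [lift, u, mk]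
  erw [RingQuot.liftAlgHom_mkAlgHom_apply]
  simp

end

theorem algHom_ext {B : Type w} [Semiring B] [Algebra k B] {f g : Schauenburg C →ₐ[k] B}
    (h : ∀ i j, f (t C i j) = g (t C i j)) (h' : ∀ i j, f (u C i j) = g (u C i j)) : f = g := by
  refine RingQuot.ringQuot_ext' k f g ?_
  ext p
  rcases p with p | p
  · exact h p.1 p.2
  · exact h' p.1 p.2

theorem comul_inverse {B : Type w} [Semiring B] [Algebra k B] (f g : Fin n → Fin n → B)
    (h : ∀ i j, ∑ a, f i a * g a j = if i = j then 1 else 0) (i j : Fin n) :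
    ∑ a, (∑ p, f i p ⊗ₜ[k] f p a) * (∑ q, g q j ⊗ₜ[k] g a q) =
      if i = j then 1 else 0 := by
  have e : ∀ a, (∑ p, f i p ⊗ₜ[k] f p a) * (∑ q, g q j ⊗ₜ[k] g a q) =
      ∑ p, ∑ q, (f i p * g q j) ⊗ₜ[k] (f p a * g a q) := by
    intro a
    simp only [Finset.sum_mul_sum, Algebra.TensorProduct.tmul_mul_tmul]
  simp only [e]
  rw [Finset.sum_comm]
  have e2 : ∀ p, ∑ a, ∑ q, (f i p * g q j) ⊗ₜ[k] (f p a * g a q) =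
      (f i p * g p j) ⊗ₜ[k] (1 : B) := by
    intro p
    rw [Finset.sum_comm]
    simp only [← TensorProduct.tmul_sum, h]
    simp [TensorProduct.tmul_ite]
  simp only [e2, ← TensorProduct.sum_tmul, h]
  split_ifs <;> simp [Algebra.TensorProduct.one_def]

theorem comul_inverse' {B : Type w} [Semiring B] [Algebra k B] (f g : Fin n → Fin n → B)
    (h : ∀ i j, ∑ a, g i a * f a j = if i = j then 1 else 0) (i j : Fin n) :
    ∑ a, (∑ q, g q a ⊗ₜ[k] g i q) * (∑ p, f a p ⊗ₜ[k] f p j) =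
      if i = j then 1 else 0 := by
  have e : ∀ a, (∑ q, g q a ⊗ₜ[k] g i q) * (∑ p, f a p ⊗ₜ[k] f p j) =
      ∑ q, ∑ p, (g q a * f a p) ⊗ₜ[k] (g i q * f p j) := by
    intro a
    simp only [Finset.sum_mul_sum, Algebra.TensorProduct.tmul_mul_tmul]
  simp only [e]
  rw [Finset.sum_comm]
  have e2 : ∀ q, ∑ a, ∑ p, (g q a * f a p) ⊗ₜ[k] (g i q * f p j) =
      (1 : B) ⊗ₜ[k] (g i q * f q j) := by
    intro p
    rw [Finset.sum_comm]
    simp only [← TensorProduct.sum_tmul, h]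
    simp [TensorProduct.ite_tmul]
  simp only [e2, ← TensorProduct.tmul_sum, h]
  split_ifs <;> simp [Algebra.TensorProduct.one_def]

/-- `𝓗(c)` is a bialgebra, with `Δ(t_i^j) = ∑ₖ t_i^k ⊗ t_k^j`, `ε(t_i^j) = δ_i^j`,
`Δ(u_i^j) = ∑ₖ u_k^j ⊗ u_i^k` and `ε(u_i^j) = δ_i^j`. -/
instance : Bialgebra k (Schauenburg C) :=
  Bialgebra.ofAlgHom
    (lift (fun i j => ∑ a, t C i a ⊗ₜ[k] t C a j) (fun i j => ∑ a, u C a j ⊗ₜ[k] u C i a)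
      (FRT.comul_rel _ _ t_rel t_rel) (comul_inverse' _ _ u_mul_t) (comul_inverse _ _ t_mul_u))
    (lift (fun i j => if i = j then 1 else 0) (fun i j => if i = j then 1 else 0)
      FRT.counit_rel (by simp) (by simp))
    (algHom_ext
      (fun i j => by
        simp [TensorProduct.sum_tmul, TensorProduct.tmul_sum]
        exact Finset.sum_comm)
      (fun i j => by
        simp [TensorProduct.sum_tmul, TensorProduct.tmul_sum]
        exact Finset.sum_comm))
    (algHom_ext (fun i j => by simp [TensorProduct.ite_tmul])
      (fun i j => by simp [TensorProduct.ite_tmul]))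
    (algHom_ext (fun i j => by simp [TensorProduct.tmul_ite])
      (fun i j => by simp [TensorProduct.tmul_ite]))

@[simp] theorem comul_t (i j : Fin n) :
    Coalgebra.comul (R := k) (t C i j) = ∑ a, t C i a ⊗ₜ[k] t C a j :=
  lift_t (C := C) _ _ _ _ _ i j

@[simp] theorem comul_u (i j : Fin n) :
    Coalgebra.comul (R := k) (u C i j) = ∑ a, u C a j ⊗ₜ[k] u C i a :=
  lift_u (C := C) _ _ _ _ _ i j

@[simp] theorem counit_t (i j : Fin n) :
    Coalgebra.counit (R := k) (t C i j) = if i = j then 1 else 0 :=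
  lift_t (C := C) _ _ _ _ _ i j

@[simp] theorem counit_u (i j : Fin n) :
    Coalgebra.counit (R := k) (u C i j) = if i = j then 1 else 0 :=
  lift_u (C := C) _ _ _ _ _ i j

end Schauenburg

end Schauenburg

/-! ### The coquasitriangular structure of `A(c)` -/

section UniversalForm

variable {k : Type u} [Field k] {n : ℕ}

theorem FRT.induction {C : Fin n → Fin n → Fin n → Fin n → k} {P : FRT C → Prop}
    (h1 : ∀ z : k, P (algebraMap k _ z)) (ht : ∀ i j, P (FRT.t C i j))
    (hmul : ∀ a b, P a → P b → P (a * b)) (hadd : ∀ a b, P a → P b → P (a + b))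
    (a : FRT C) : P a := by
  obtain ⟨p, rfl⟩ : ∃ p, FRT.mk C p = a := RingQuot.mkAlgHom_surjective k (FRTRel C) a
  induction p using FreeAlgebra.induction with
  | grade0 z => simpa using h1 z
  | grade1 q => exact ht q.1 q.2
  | mul a b ha hb => simpa using hmul _ _ ha hb
  | add a b ha hb => simpa using hadd _ _ ha hb

/-- The braid equation in coordinates. -/
def YBCoeff (C : Fin n → Fin n → Fin n → Fin n → k) : Prop :=
  ∀ i j q p r s : Fin n,
    ∑ a, ∑ b, ∑ m, C i j a b * C b q m s * C a m p r =
      ∑ a, ∑ b, ∑ m, C j q m b * C i m p a * C a b r s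

namespace YBCoeff

variable {C : Fin n → Fin n → Fin n → Fin n → k} (h : YBCoeff C)

/-- The matrix representation of `A(c)` whose `(k, i)` entry is `r(t_i^k, -)`, where
`r(t_i^k, t_j^l) = c_{ji}^{kl}`. -/
def matHom (h : YBCoeff C) : FRT C →ₐ[k] Matrix (Fin n) (Fin n) k :=
  FRT.lift (fun j l => Matrix.of fun a i => C j i a l) (by
    intro i j r s
    ext p q
    have := h i j q p r s
    simp only [Matrix.sum_apply, Matrix.smul_apply, Matrix.mul_apply, Matrix.of_apply,
      smul_eq_mul, Finset.mul_sum]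
    refine Eq.trans ?_ (this.trans ?_) <;>
      exact Finset.sum_congr rfl fun _ _ => Finset.sum_congr rfl fun _ _ =>
        Finset.sum_congr rfl fun _ _ => by ring)

@[simp] theorem matHom_t (i j a b : Fin n) : h.matHom (FRT.t C i j) a b = C i b a j := by
  simp [matHom]

/-- The functional `r(t_i^j, -)` on `A(c)`. -/
def fnl (h : YBCoeff C) (i j : Fin n) : FRT C →ₗ[k] k :=
  Matrix.entryLinearMap k k j i ∘ₗ h.matHom.toLinearMap

@[simp] theorem fnl_apply (i j : Fin n) (a : FRT C) : h.fnl i j a = h.matHom a j i := rfl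

theorem fnl_mul (i j : Fin n) (a b : FRT C) :
    h.fnl i j (a * b) = ∑ m, h.fnl m j a * h.fnl i m b := by
  simp [Matrix.mul_apply]

/-- The matrix with `((i, j), (r, s))` entry `r(t_i^r, X₁) r(t_j^s, X₂)`. -/
def mat₂ (h : YBCoeff C) (X : FRT C) : Matrix (Fin n × Fin n) (Fin n × Fin n) k :=
  Matrix.of fun p q => LinearMap.mul' k k
    (TensorProduct.map (h.fnl p.1 q.1) (h.fnl p.2 q.2) (Coalgebra.comul X))

theorem mat₂_mul (X Y : FRT C) : h.mat₂ (X * Y) = h.mat₂ Y * h.mat₂ X := by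
  have mulE : ∀ (i j r s : Fin n) (X Y : FRT C ⊗[k] FRT C),
      LinearMap.mul' k k (TensorProduct.map (h.fnl i r) (h.fnl j s) (X * Y)) =
      ∑ a, ∑ b, LinearMap.mul' k k (TensorProduct.map (h.fnl i a) (h.fnl j b) Y) *
        LinearMap.mul' k k (TensorProduct.map (h.fnl a r) (h.fnl b s) X) := by
    intro i j r s X Y
    induction X with
    | zero => simp
    | add X₁ X₂ h₁ h₂ =>
      simp only [add_mul, mul_add, map_add, h₁, h₂, Finset.sum_add_distrib]
    | tmul x₁ x₂ =>
      induction Y with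
      | zero => simp
      | add X₁ X₂ h₁ h₂ =>
        simp only [mul_add, add_mul, map_add, h₁, h₂, Finset.sum_add_distrib]
      | tmul y₁ y₂ =>
        simp only [Algebra.TensorProduct.tmul_mul_tmul, TensorProduct.map_tmul,
          LinearMap.mul'_apply, fnl_mul, Finset.sum_mul_sum]
        exact Finset.sum_congr rfl fun _ _ => Finset.sum_congr rfl fun _ _ => by ring
  ext p q
  simp only [mat₂, Matrix.mul_apply, Matrix.of_apply, Bialgebra.comul_mul, mulE,
    Fintype.sum_prod_type]

theorem mat₂_comm (X : FRT C) :
    (Matrix.of fun p q : Fin n × Fin n => C p.1 p.2 q.1 q.2) * h.mat₂ X =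
      h.mat₂ X * Matrix.of fun p q : Fin n × Fin n => C p.1 p.2 q.1 q.2 := by
  induction X using FRT.induction with
  | h1 z =>
    have : h.mat₂ (algebraMap k _ z) = z • 1 := by
      ext p q
      simp [mat₂, Algebra.algebraMap_eq_smul_one, Algebra.TensorProduct.one_def,
        Matrix.one_apply, Prod.ext_iff, eq_comm, ← ite_and, and_comm]
    simp [this]
  | ht a b =>
    ext ⟨i, j⟩ ⟨r, s⟩
    have := h a i j r s b
    simp only [mat₂, Matrix.mul_apply, Matrix.of_apply, FRT.comul_t, map_sum,
      TensorProduct.map_tmul, LinearMap.mul'_apply, fnl_apply, matHom_t, Fintype.sum_prod_type,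
      Finset.mul_sum, Finset.sum_mul]
    have e1 : ∑ x, ∑ y, ∑ m, C i j x y * (C a x r m * C m y s b) =
        ∑ m, ∑ y, ∑ x, C i j x y * C a x r m * C m y s b := by
      rw [Finset.sum_comm, Finset.sum_congr rfl fun _ _ => Finset.sum_comm, Finset.sum_comm]
      simp only [mul_assoc]
    have e2 : ∑ x, ∑ y, ∑ m, C a i x m * C m j y b * C x y r s =
        ∑ x, ∑ m, ∑ y, C a i x m * C m j y b * C x y r s :=
      Finset.sum_congr rfl fun _ _ => Finset.sum_comm
    rw [e1, e2, this]
  | hadd X Y hX hY =>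
    have : h.mat₂ (X + Y) = h.mat₂ X + h.mat₂ Y := by ext p q; simp [mat₂]
    simp only [this, mul_add, add_mul, hX, hY]
  | hmul X Y hX hY =>
    rw [mat₂_mul, ← mul_assoc, hY, mul_assoc, hX, mul_assoc]

/-- The algebra map `a ↦ r(a, -)` from `A(c)` to its convolution dual. -/
def conv (h : YBCoeff C) : FRT C →ₐ[k] WithConv (FRT C →ₗ[k] k) :=
  FRT.lift (fun i j => WithConv.toConv (h.fnl i j)) (by
    intro i j r s
    ext X
    have := congrFun (congrFun (h.mat₂_comm X) (i, j)) (r, s)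
    simpa [Matrix.mul_apply, Fintype.sum_prod_type, mat₂, LinearMap.convMul_def, mul_comm]
      using this)

/-- The universal form `r` on `A(c)`: the unique form with
`r(t_i^k, t_j^l) = c_{ji}^{kl}`, `r(ab,c) = r(a,c₁) r(b,c₂)` and `r(a,bc) = r(a₁,c) r(a₂,b)`. -/
def form (h : YBCoeff C) : FRT C ⊗[k] FRT C →ₗ[k] k :=
  TensorProduct.lift ((WithConv.linearEquiv k _).toLinearMap ∘ₗ h.conv.toLinearMap)

theorem form_tmul (a b : FRT C) : h.form (a ⊗ₜ b) = (h.conv a).ofConv b := by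
  simp [form]

theorem conv_t (i j : Fin n) : h.conv (FRT.t C i j) = WithConv.toConv (h.fnl i j) := by
  simp [conv]

theorem form_t_left (i j : Fin n) (a : FRT C) : h.form (FRT.t C i j ⊗ₜ a) = h.fnl i j a := by
  rw [form_tmul, conv_t]

/-- `r(t_i^k, t_j^l) = c_{ji}^{kl}`. -/
theorem form_t (i j a b : Fin n) : h.form (FRT.t C i a ⊗ₜ FRT.t C j b) = C j i a b := by
  rw [form_t_left, fnl_apply, matHom_t]

theorem form_mul_left (a b c : FRT C) : h.form ((a * b) ⊗ₜ c) =
    LinearMap.mul' k k (TensorProduct.map (TensorProduct.curry h.form a)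
      (TensorProduct.curry h.form b) (Coalgebra.comul c)) := by
  have e : ∀ a, TensorProduct.curry h.form a = (h.conv a).ofConv := fun a => by
    ext b; simp [form_tmul]
  rw [form_tmul, map_mul, e, e]
  rfl

theorem form_mul_right (a b c : FRT C) : h.form (a ⊗ₜ (b * c)) =
    LinearMap.mul' k k (TensorProduct.map ((TensorProduct.curry h.form).flip c)
      ((TensorProduct.curry h.form).flip b) (Coalgebra.comul a)) := by
  induction a using FRT.induction generalizing b c with
  | h1 z =>
    simp [Algebra.algebraMap_eq_smul_one, Algebra.TensorProduct.one_def, form_tmul,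
      LinearMap.convOne_def, mul_comm]
  | ht i j =>
    simp [form_t_left, fnl_mul, mul_comm, -fnl_apply]
  | hadd x y hx hy => simp only [TensorProduct.add_tmul, map_add, hx, hy]
  | hmul x y hx hy =>
    have rx := (Coalgebra.Repr.arbitrary k x)
    have ry := (Coalgebra.Repr.arbitrary k y)
    have rb := (Coalgebra.Repr.arbitrary k b)
    have rc := (Coalgebra.Repr.arbitrary k c)
    rw [form_mul_left, Bialgebra.comul_mul, Bialgebra.comul_mul, ← rx.eq, ← ry.eq, ← rb.eq,
      ← rc.eq]
    simp only [Finset.sum_mul_sum, Algebra.TensorProduct.tmul_mul_tmul, map_sum,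
      TensorProduct.map_tmul, LinearMap.mul'_apply, TensorProduct.curry_apply,
      LinearMap.flip_apply, hx, hy, form_mul_left, ← rx.eq, ← ry.eq, ← rb.eq, ← rc.eq]
    have sw : ∀ (s₁ s₂ s₃ s₄ : Finset (FRT C × FRT C))
        (F : FRT C × FRT C → FRT C × FRT C → FRT C × FRT C → FRT C × FRT C → k),
        ∑ b ∈ s₁, ∑ c ∈ s₂, ∑ x ∈ s₃, ∑ y ∈ s₄, F b c x y =
          ∑ x ∈ s₃, ∑ y ∈ s₄, ∑ c ∈ s₂, ∑ b ∈ s₁, F b c x y := by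
      intro s₁ s₂ s₃ s₄ F
      have := Finset.sum_comm (s := s₁ ×ˢ s₂) (t := s₃ ×ˢ s₄)
        (f := fun p q => F p.1 p.2 q.1 q.2)
      simp only [Finset.sum_product] at this
      rw [this]
      exact Finset.sum_congr rfl fun _ _ => Finset.sum_congr rfl fun _ _ => Finset.sum_comm
    rw [sw]
    exact Finset.sum_congr rfl fun _ _ => Finset.sum_congr rfl fun _ _ =>
      Finset.sum_congr rfl fun _ _ => Finset.sum_congr rfl fun _ _ => by ring

theorem form_comm_t (i j : Fin n) (b : FRT C) :
    ∑ m, TensorProduct.lid k (FRT C) (TensorProduct.map (h.fnl i m)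
        (LinearMap.mulLeft k (FRT.t C m j)) (Coalgebra.comul b)) =
      ∑ m, TensorProduct.rid k (FRT C) (TensorProduct.map
        (LinearMap.mulRight k (FRT.t C i m)) (h.fnl m j) (Coalgebra.comul b)) := by
  have lmul : ∀ (i j : Fin n) (X Y : FRT C ⊗[k] FRT C),
      ∑ m, TensorProduct.lid k (FRT C) (TensorProduct.map (h.fnl i m)
        (LinearMap.mulLeft k (FRT.t C m j)) (X * Y)) =
      ∑ p, TensorProduct.lid k (FRT C) (TensorProduct.map (h.fnl i p)
        (LinearMap.mulLeft k (∑ m, TensorProduct.lid k (FRT C) (TensorProduct.map (h.fnl p m)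
        (LinearMap.mulLeft k (FRT.t C m j)) X))) Y) := by
    intro i j X Y
    induction Y with
    | zero => simp
    | add X₁ X₂ h₁ h₂ => simp only [mul_add, map_add, h₁, h₂, Finset.sum_add_distrib]
    | tmul y₁ y₂ =>
      induction X with
      | zero => simp
      | add X₁ X₂ h₁ h₂ =>
        simp only [add_mul, map_add, h₁, h₂, Finset.sum_add_distrib, TensorProduct.map_tmul,
          LinearMap.mulLeft_apply, TensorProduct.lid_tmul, smul_add]
      | tmul x₁ x₂ =>
        simp only [Algebra.TensorProduct.tmul_mul_tmul, TensorProduct.map_tmul, fnl_mul,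
          TensorProduct.lid_tmul, LinearMap.mulLeft_apply, Finset.sum_smul, Finset.sum_mul,
          Finset.smul_sum]
        rw [Finset.sum_comm]
        refine Finset.sum_congr rfl fun _ _ => Finset.sum_congr rfl fun _ _ => ?_
        rw [smul_mul_assoc, smul_smul, mul_comm, mul_assoc]
  have rmul : ∀ (i j : Fin n) (X Y : FRT C ⊗[k] FRT C),
      ∑ m, TensorProduct.rid k (FRT C) (TensorProduct.map
        (LinearMap.mulRight k (FRT.t C i m)) (h.fnl m j) (X * Y)) =
      ∑ p, TensorProduct.rid k (FRT C) (TensorProduct.map (LinearMap.mulRight k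
        (∑ m, TensorProduct.rid k (FRT C) (TensorProduct.map
          (LinearMap.mulRight k (FRT.t C i m)) (h.fnl m p) Y))) (h.fnl p j) X) := by
    intro i j X Y
    induction X with
    | zero => simp
    | add X₁ X₂ h₁ h₂ => simp only [add_mul, map_add, h₁, h₂, Finset.sum_add_distrib]
    | tmul x₁ x₂ =>
      induction Y with
      | zero => simp
      | add X₁ X₂ h₁ h₂ =>
        simp only [mul_add, map_add, h₁, h₂, Finset.sum_add_distrib, TensorProduct.map_tmul,
          LinearMap.mulRight_apply, TensorProduct.rid_tmul, smul_add]
      | tmul y₁ y₂ =>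
        simp only [Algebra.TensorProduct.tmul_mul_tmul, TensorProduct.map_tmul, fnl_mul,
          TensorProduct.rid_tmul, LinearMap.mulRight_apply, Finset.sum_smul, Finset.mul_sum,
          Finset.smul_sum]
        rw [Finset.sum_comm]
        refine Finset.sum_congr rfl fun _ _ => Finset.sum_congr rfl fun _ _ => ?_
        rw [mul_smul_comm, smul_smul, mul_assoc]
  have mid : ∀ (i j : Fin n) (X Y : FRT C ⊗[k] FRT C),
      ∑ p, TensorProduct.lid k (FRT C) (TensorProduct.map (h.fnl i p)
        (LinearMap.mulLeft k (∑ m, TensorProduct.rid k (FRT C) (TensorProduct.map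
          (LinearMap.mulRight k (FRT.t C p m)) (h.fnl m j) X))) Y) =
      ∑ p, TensorProduct.rid k (FRT C) (TensorProduct.map (LinearMap.mulRight k
        (∑ m, TensorProduct.lid k (FRT C) (TensorProduct.map (h.fnl i m)
        (LinearMap.mulLeft k (FRT.t C m p)) Y))) (h.fnl p j) X) := by
    intro i j X Y
    induction X with
    | zero => simp
    | add X₁ X₂ h₁ h₂ =>
      have ml : ∀ u v : FRT C, LinearMap.mulLeft k (u + v) =
          LinearMap.mulLeft k u + LinearMap.mulLeft k v := fun u v => by ext; simp [add_mul]
      simp only [map_add, Finset.sum_add_distrib, ml, TensorProduct.map_add_right,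
        LinearMap.add_apply, h₁, h₂]
    | tmul x₁ x₂ =>
      induction Y with
      | zero => simp
      | add X₁ X₂ h₁ h₂ =>
        simp only [TensorProduct.map_tmul, LinearMap.mulRight_apply,
          TensorProduct.rid_tmul] at h₁ h₂
        simp only [map_add, h₁, h₂, Finset.sum_add_distrib, TensorProduct.map_tmul,
          LinearMap.mulRight_apply, TensorProduct.rid_tmul, smul_add, mul_add]
      | tmul y₁ y₂ =>
        simp only [TensorProduct.map_tmul, TensorProduct.rid_tmul, LinearMap.mulRight_apply,
          TensorProduct.lid_tmul, LinearMap.mulLeft_apply, Finset.sum_mul, Finset.mul_sum,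
          Finset.smul_sum]
        rw [Finset.sum_comm]
        refine Finset.sum_congr rfl fun _ _ => Finset.sum_congr rfl fun _ _ => ?_
        rw [smul_mul_assoc, mul_smul_comm, smul_comm, mul_assoc]
  induction b using FRT.induction generalizing i j with
  | h1 z =>
    simp [Algebra.algebraMap_eq_smul_one, Algebra.TensorProduct.one_def, Matrix.one_apply,
      ite_smul]
  | ht p q =>
    have := FRT.t_rel (C := C) p i j q
    simp only [FRT.comul_t, map_sum, TensorProduct.map_tmul, fnl_apply, matHom_t,
      LinearMap.mulLeft_apply, LinearMap.mulRight_apply, TensorProduct.lid_tmul,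
      TensorProduct.rid_tmul]
    rw [this, Finset.sum_comm]
  | hadd x y hx hy => simp only [map_add, Finset.sum_add_distrib, hx, hy]
  | hmul x y hx hy =>
    rw [Bialgebra.comul_mul, lmul, rmul]
    simp only [hx, ← hy]
    exact mid i j _ _

theorem form_one_right (a : FRT C) : h.form (a ⊗ₜ 1) = Coalgebra.counit (R := k) a := by
  induction a using FRT.induction with
  | h1 z => simp [form_tmul, Algebra.algebraMap_eq_smul_one, LinearMap.convOne_def]
  | ht i j => simp [form_t_left, Matrix.one_apply, eq_comm]
  | hadd x y hx hy => simp only [TensorProduct.add_tmul, map_add, hx, hy]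
  | hmul x y hx hy => simp [form_mul_left, Algebra.TensorProduct.one_def, hx, hy]

section

variable {A : Type u} [Ring A] [Bialgebra k A]

theorem const_conv (a : A) (f : A →ₗ[k] A) :
    WithConv.toConv (LinearMap.toSpanSingleton k A a ∘ₗ Coalgebra.counit) * WithConv.toConv f =
      WithConv.toConv (LinearMap.mulLeft k a ∘ₗ f) := by
  ext b
  have e : TensorProduct.map (LinearMap.toSpanSingleton k A a ∘ₗ Coalgebra.counit) f =
      TensorProduct.map (LinearMap.toSpanSingleton k A a) f ∘ₗ
        LinearMap.rTensor A (Coalgebra.counit (R := k) (A := A)) := by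
    ext; simp
  simp only [LinearMap.convMul_def, LinearMap.comp_apply, e, Coalgebra.rTensor_counit_comul]
  simp

theorem conv_const (a : A) (f : A →ₗ[k] A) :
    WithConv.toConv f * WithConv.toConv (LinearMap.toSpanSingleton k A a ∘ₗ Coalgebra.counit) =
      WithConv.toConv (LinearMap.mulRight k a ∘ₗ f) := by
  ext b
  have e : TensorProduct.map f (LinearMap.toSpanSingleton k A a ∘ₗ Coalgebra.counit) =
      TensorProduct.map f (LinearMap.toSpanSingleton k A a) ∘ₗ
        LinearMap.lTensor A (Coalgebra.counit (R := k) (A := A)) := by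
    ext; simp
  simp only [LinearMap.convMul_def, LinearMap.comp_apply, e, Coalgebra.lTensor_counit_comul]
  simp

/-- The algebra map sending `a` to the map `b ↦ ε(b) a`. -/
def constConv (k : Type u) [Field k] (A : Type u) [Ring A] [Bialgebra k A] :
    A →ₐ[k] WithConv (A →ₗ[k] A) where
  toFun a := WithConv.toConv ((LinearMap.toSpanSingleton k A a) ∘ₗ Coalgebra.counit)
  map_one' := by ext b; simp [Algebra.algebraMap_eq_smul_one]
  map_mul' a b := by rw [const_conv]; ext c; simp
  map_zero' := by ext; simp
  map_add' a b := by ext; simp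
  commutes' z := by ext b; simp [Algebra.algebraMap_eq_smul_one, mul_comm, smul_smul]

end

/-- The algebra map sending `a` to the map `b ↦ r(a,b) 1`. -/
def scalConv (h : YBCoeff C) : FRT C →ₐ[k] WithConv (FRT C →ₗ[k] FRT C) where
  toFun a := WithConv.toConv (Algebra.linearMap k (FRT C) ∘ₗ (h.conv a).ofConv)
  map_one' := by rw [map_one]; rfl
  map_mul' a b := by
    have := LinearMap.algHom_comp_convMul_distrib (Algebra.ofId k (FRT C)) (h.conv a) (h.conv b)
    rw [map_mul]
    exact congrArg WithConv.toConv this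
  map_zero' := by ext; simp
  map_add' a b := by ext; simp
  commutes' z := by ext b; simp [Algebra.algebraMap_eq_smul_one, smul_smul]

theorem scal_const_commute (a b : FRT C) :
    Commute (h.scalConv a) (constConv k (FRT C) b) := by
  have : WithConv.toConv (Algebra.linearMap k (FRT C) ∘ₗ (h.conv a).ofConv) *
      WithConv.toConv (LinearMap.toSpanSingleton k (FRT C) b ∘ₗ Coalgebra.counit) =
      WithConv.toConv (LinearMap.toSpanSingleton k (FRT C) b ∘ₗ Coalgebra.counit) *
      WithConv.toConv (Algebra.linearMap k (FRT C) ∘ₗ (h.conv a).ofConv) := by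
    rw [const_conv, conv_const]
    ext c
    simp [Algebra.algebraMap_eq_smul_one]
  exact this

theorem form_comm_left (X : FRT C ⊗[k] FRT C) (b : FRT C) : ((Algebra.TensorProduct.lift h.scalConv
    (constConv k (FRT C)) h.scal_const_commute X) * WithConv.toConv LinearMap.id).ofConv b =
    TensorProduct.lid k (FRT C) (TensorProduct.map h.form (LinearMap.mul' k (FRT C))
      (TensorProduct.tensorTensorTensorComm k _ _ _ _ (X ⊗ₜ[k] Coalgebra.comul b))) := by
  induction X with
  | zero => simp
  | add x y hx hy => simp only [map_add, add_mul, TensorProduct.add_tmul, hx, hy,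
      WithConv.ofConv_add, LinearMap.add_apply]
  | tmul x y =>
    rw [Algebra.TensorProduct.lift_tmul, mul_assoc]
    have : constConv k (FRT C) y * WithConv.toConv LinearMap.id =
      WithConv.toConv (LinearMap.mulLeft k y ∘ₗ LinearMap.id) := const_conv _ _
    rw [this]
    change LinearMap.mul' k _ (TensorProduct.map (Algebra.linearMap k (FRT C) ∘ₗ
      (h.conv x).ofConv) (LinearMap.mulLeft k y ∘ₗ LinearMap.id) (Coalgebra.comul b)) = _
    induction (Coalgebra.comul b : FRT C ⊗[k] FRT C) with
    | zero => simp
    | add x y hx hy => simp only [map_add, TensorProduct.tmul_add, hx, hy]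
    | tmul p q => simp [form_tmul, Algebra.algebraMap_eq_smul_one]

theorem form_comm_right (X : FRT C ⊗[k] FRT C) (b : FRT C) : (WithConv.toConv LinearMap.id *
    (Algebra.TensorProduct.lift (constConv k (FRT C)) h.scalConv
        (fun x y => (h.scal_const_commute y x).symm) X)).ofConv b =
    TensorProduct.rid k (FRT C) (TensorProduct.map
    (LinearMap.mul' k (FRT C) ∘ₗ (TensorProduct.comm k (FRT C) (FRT C)).toLinearMap) h.form
      (TensorProduct.tensorTensorTensorComm k _ _ _ _ (X ⊗ₜ[k] Coalgebra.comul b))) := by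
  induction X with
  | zero => simp
  | add x y hx hy => simp only [map_add, mul_add, TensorProduct.add_tmul, hx, hy,
      WithConv.ofConv_add, LinearMap.add_apply]
  | tmul x y =>
    rw [Algebra.TensorProduct.lift_tmul, ← mul_assoc]
    have : WithConv.toConv LinearMap.id * constConv k (FRT C) x =
      WithConv.toConv (LinearMap.mulRight k x ∘ₗ LinearMap.id) := conv_const _ _
    rw [this]
    change LinearMap.mul' k _ (TensorProduct.map (LinearMap.mulRight k x ∘ₗ LinearMap.id)
      (Algebra.linearMap k (FRT C) ∘ₗ (h.conv y).ofConv) (Coalgebra.comul b)) = _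
    induction (Coalgebra.comul b : FRT C ⊗[k] FRT C) with
    | zero => simp
    | add x y hx hy => simp only [map_add, TensorProduct.tmul_add, hx, hy]
    | tmul p q => simp [form_tmul, Algebra.algebraMap_eq_smul_one]

theorem form_comm_aux (a : FRT C) :
    Algebra.TensorProduct.lift h.scalConv (constConv k (FRT C)) h.scal_const_commute
        (Coalgebra.comul a) * WithConv.toConv LinearMap.id =
      WithConv.toConv LinearMap.id *
        Algebra.TensorProduct.lift (constConv k (FRT C)) h.scalConv
          (fun x y => (h.scal_const_commute y x).symm) (Coalgebra.comul a) := by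
  induction a using FRT.induction with
  | h1 z =>
    simp [Algebra.algebraMap_eq_smul_one, Algebra.TensorProduct.one_def]
  | ht i j =>
    ext b
    have := h.form_comm_t i j b
    have e₁ : ∀ m Y, TensorProduct.lid k (FRT C) (TensorProduct.map h.form
        (LinearMap.mul' k (FRT C)) (TensorProduct.tensorTensorTensorComm k _ _ _ _
          ((FRT.t C i m ⊗ₜ[k] FRT.t C m j) ⊗ₜ[k] Y))) =
        TensorProduct.lid k (FRT C) (TensorProduct.map (h.fnl i m)
          (LinearMap.mulLeft k (FRT.t C m j)) Y) := by
      intro m Y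
      induction Y with
      | zero => simp
      | add x y hx hy => simp only [map_add, TensorProduct.tmul_add, hx, hy]
      | tmul p q => simp [form_t_left]
    have e₂ : ∀ m Y, TensorProduct.rid k (FRT C) (TensorProduct.map
        (LinearMap.mul' k (FRT C) ∘ₗ (TensorProduct.comm k (FRT C) (FRT C)).toLinearMap) h.form
          (TensorProduct.tensorTensorTensorComm k _ _ _ _
          ((FRT.t C i m ⊗ₜ[k] FRT.t C m j) ⊗ₜ[k] Y))) =
        TensorProduct.rid k (FRT C) (TensorProduct.map
          (LinearMap.mulRight k (FRT.t C i m)) (h.fnl m j) Y) := by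
      intro m Y
      induction Y with
      | zero => simp
      | add x y hx hy => simp only [map_add, TensorProduct.tmul_add, hx, hy]
      | tmul p q => simp [form_t_left]
    rw [form_comm_left, form_comm_right]
    simpa only [FRT.comul_t, TensorProduct.sum_tmul, map_sum, e₁, e₂] using this
  | hadd x y hx hy => simp only [map_add, add_mul, mul_add, hx, hy]
  | hmul x y hx hy =>
    rw [Bialgebra.comul_mul, map_mul, map_mul, mul_assoc, hy, ← mul_assoc, hx, mul_assoc]

theorem form_comm (a b : FRT C) :
    TensorProduct.lid k (FRT C) (TensorProduct.map h.form (LinearMap.mul' k (FRT C))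
      (Coalgebra.comul (R := k) (a ⊗ₜ[k] b))) =
    TensorProduct.rid k (FRT C) (TensorProduct.map
      (LinearMap.mul' k (FRT C) ∘ₗ (TensorProduct.comm k (FRT C) (FRT C)).toLinearMap) h.form
      (Coalgebra.comul (R := k) (a ⊗ₜ[k] b))) := by
  have key := congrArg (fun f => f.ofConv b) (h.form_comm_aux a)
  simp only [form_comm_left, form_comm_right] at key
  exact key


variable {C' : Fin n → Fin n → Fin n → Fin n → k}

/-- `C` and `C'` are the coefficients of mutually inverse maps. -/
def IsInverse (C C' : Fin n → Fin n → Fin n → Fin n → k) : Prop :=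
  ∀ i j r s, ∑ a, ∑ b, C i j a b * C' a b r s = if i = r ∧ j = s then 1 else 0

theorem IsInverse.mul_eq_one (hi : IsInverse C C') :
    (Matrix.of fun p q : Fin n × Fin n => C p.1 p.2 q.1 q.2) *
      (Matrix.of fun p q : Fin n × Fin n => C' p.1 p.2 q.1 q.2) = 1 := by
  ext p q
  simp [Matrix.mul_apply, Fintype.sum_prod_type, hi p.1 p.2 q.1 q.2, Matrix.one_apply,
    Prod.ext_iff]

theorem IsInverse.symm (hi : IsInverse C C') : IsInverse C' C := by
  intro i j r s
  have h₀ := mul_eq_one_comm.1 (IsInverse.mul_eq_one hi)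
  have := congrFun (congrFun h₀ (i, j)) (r, s)
  simpa [Matrix.mul_apply, Fintype.sum_prod_type, Matrix.one_apply, Prod.ext_iff] using this

/-- The identification `A(c) → A(c⁻¹)`, `t_i^j ↦ t_i^j`. -/
def flipInv (hi : IsInverse C C') : FRT C →ₐ[k] FRT C' :=
  FRT.lift (FRT.t C') (by
    let M : Matrix (Fin n × Fin n) (Fin n × Fin n) (FRT C') := Matrix.of fun p q =>
      algebraMap k (FRT C') (C p.1 p.2 q.1 q.2)
    let M' : Matrix (Fin n × Fin n) (Fin n × Fin n) (FRT C') := Matrix.of fun p q =>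
      algebraMap k (FRT C') (C' p.1 p.2 q.1 q.2)
    let T : Matrix (Fin n × Fin n) (Fin n × Fin n) (FRT C') := Matrix.of fun p q =>
      FRT.t C' p.1 q.1 * FRT.t C' p.2 q.2
    have h₁ : M * M' = 1 := by
      have := congrArg (fun Z => Z.map (algebraMap k (FRT C'))) (IsInverse.mul_eq_one hi)
      rw [Matrix.map_mul, Matrix.map_one _ (map_zero _) (map_one _)] at this
      exact this
    have h₂ : M' * M = 1 := by
      have := congrArg (fun Z => Z.map (algebraMap k (FRT C')))
        (IsInverse.mul_eq_one (IsInverse.symm hi))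
      rw [Matrix.map_mul, Matrix.map_one _ (map_zero _) (map_one _)] at this
      exact this
    have h₃ : M' * T = T * M' := by
      ext p q
      have := FRT.t_rel (C := C') p.1 p.2 q.1 q.2
      simp only [Algebra.smul_def] at this
      simp only [Matrix.mul_apply, M', T, Fintype.sum_prod_type, Matrix.of_apply]
      exact this.trans (Finset.sum_congr rfl fun _ _ => Finset.sum_congr rfl fun _ _ =>
        Algebra.commutes _ _)
    have h₄ : M * T = T * M := by
      calc M * T = M * T * (M' * M) := by rw [h₂, mul_one]
        _ = M * (T * M') * M := by simp only [mul_assoc]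
        _ = (M * M') * T * M := by rw [← h₃]; simp only [mul_assoc]
        _ = T * M := by rw [h₁, one_mul]
    intro i j r s
    have := congrFun (congrFun h₄ (i, j)) (r, s)
    simp only [Matrix.mul_apply, M, T, Fintype.sum_prod_type, Matrix.of_apply] at this
    simp only [Algebra.smul_def]
    exact this.trans (Finset.sum_congr rfl fun _ _ => Finset.sum_congr rfl fun _ _ =>
      (Algebra.commutes _ _).symm))

@[simp] theorem flipInv_t (hi : IsInverse C C') (i j : Fin n) :
    flipInv hi (FRT.t C i j) = FRT.t C' i j := FRT.lift_t _ _ i j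

theorem flipInv_flipInv (hi : IsInverse C C') (a : FRT C) :
    flipInv (IsInverse.symm hi) (flipInv hi a) = a := by
  have : (flipInv (IsInverse.symm hi)).comp (flipInv hi) = AlgHom.id k _ :=
    FRT.algHom_ext fun i j => by simp
  exact DFunLike.congr_fun this a

theorem comul_flipInv (hi : IsInverse C C') (a : FRT C) :
    Coalgebra.comul (R := k) (flipInv hi a) =
      TensorProduct.map (flipInv hi).toLinearMap (flipInv hi).toLinearMap (Coalgebra.comul a) := by
  have : (Bialgebra.comulAlgHom k _).comp (flipInv hi) =
      (Algebra.TensorProduct.map (flipInv hi) (flipInv hi)).comp (Bialgebra.comulAlgHom k _) :=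
    FRT.algHom_ext fun i j => by simp
  exact DFunLike.congr_fun this a

theorem counit_flipInv (hi : IsInverse C C') (a : FRT C) :
    Coalgebra.counit (R := k) (flipInv hi a) = Coalgebra.counit (R := k) a := by
  have : (Bialgebra.counitAlgHom k _).comp (flipInv hi) = Bialgebra.counitAlgHom k _ :=
    FRT.algHom_ext fun i j => by simp
  exact DFunLike.congr_fun this a

/-- The convolution inverse of the universal form of `A(c)`:
`r⁻¹(a, b) = r'(b, a)`, where `r'` is the universal form of `A(c⁻¹) = A(c)`. -/
def invForm (hi : IsInverse C C') (h' : YBCoeff C') : FRT C ⊗[k] FRT C →ₗ[k] k :=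
  h'.form ∘ₗ TensorProduct.map (flipInv hi).toLinearMap (flipInv hi).toLinearMap ∘ₗ
    (TensorProduct.comm k _ _).toLinearMap

variable (hi : IsInverse C C') (h' : YBCoeff C')

theorem invForm_tmul (a b : FRT C) :
    invForm hi h' (a ⊗ₜ b) = h'.form (flipInv hi b ⊗ₜ flipInv hi a) := by
  simp [invForm]


/-- The functional `r⁻¹(t_i^j, -)`. -/
def invFnl (i j : Fin n) : FRT C →ₗ[k] k :=
  TensorProduct.curry (invForm hi h') (FRT.t C i j)

theorem invFnl_mul (i j : Fin n) (a b : FRT C) : invFnl hi h' i j (a * b) =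
    ∑ m, invFnl hi h' i m a * invFnl hi h' m j b := by
  simp [invFnl, invForm_tmul, form_mul_left]

theorem inv_t (i j : Fin n) (b : FRT C) :
    ∑ m, LinearMap.mul' k k (TensorProduct.map (h.fnl i m) (invFnl hi h' m j)
      (Coalgebra.comul b)) = if i = j then Coalgebra.counit (R := k) b else 0 := by
  have mulE : ∀ (i j : Fin n) (X Y : FRT C ⊗[k] FRT C),
      ∑ m, LinearMap.mul' k k (TensorProduct.map (h.fnl i m) (invFnl hi h' m j) (X * Y)) =
      ∑ p, ∑ q, (∑ m, LinearMap.mul' k k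
          (TensorProduct.map (h.fnl p m) (invFnl hi h' m q) X)) *
        LinearMap.mul' k k (TensorProduct.map (h.fnl i p) (invFnl hi h' q j) Y) := by
    intro i j X Y
    induction X with
    | zero => simp
    | add X₁ X₂ h₁ h₂ =>
      simp only [add_mul, map_add, h₁, h₂, Finset.sum_add_distrib]
    | tmul x₁ x₂ =>
      induction Y with
      | zero => simp
      | add X₁ X₂ h₁ h₂ =>
        simp only [mul_add, map_add, h₁, h₂, Finset.sum_add_distrib]
      | tmul y₁ y₂ =>
        simp only [Algebra.TensorProduct.tmul_mul_tmul, TensorProduct.map_tmul,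
          LinearMap.mul'_apply, fnl_mul, invFnl_mul, Finset.sum_mul]
        rw [Finset.sum_comm]
        refine Finset.sum_congr rfl fun _ _ => ?_
        simp only [Finset.mul_sum]
        rw [Finset.sum_comm]
        exact Finset.sum_congr rfl fun _ _ => Finset.sum_congr rfl fun _ _ => by ring
  induction b using FRT.induction generalizing i j with
  | h1 z =>
    have : ∀ m, invFnl hi h' m j 1 = if m = j then 1 else 0 := fun m => by
      simp [invFnl, invForm_tmul, form_tmul, LinearMap.convOne_def]
    have h₂ : ∀ m, h.fnl i m 1 = if i = m then 1 else 0 := fun m => by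
      simp [Matrix.one_apply, eq_comm]
    simp only [Algebra.algebraMap_eq_smul_one, Algebra.TensorProduct.one_def, map_smul,
      Bialgebra.comul_one, Bialgebra.counit_one, TensorProduct.map_tmul, LinearMap.mul'_apply,
      this, h₂]
    simp
  | ht p q =>
    have := hi p i q j
    simp only [FRT.comul_t, map_sum, TensorProduct.map_tmul, LinearMap.mul'_apply, fnl_apply,
      matHom_t, invFnl, TensorProduct.curry_apply, invForm_tmul, flipInv_t, form_t,
      FRT.counit_t]
    rw [this]
    split_ifs <;> simp_all
  | hadd x y hx hy =>
    simp only [map_add, Finset.sum_add_distrib, hx, hy]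
    split_ifs <;> simp
  | hmul x y hx hy =>
    rw [Bialgebra.comul_mul, mulE]
    simp only [hx, ite_mul, zero_mul, Finset.sum_ite_eq, Finset.mem_univ, if_true,
      ← Finset.mul_sum, hy]
    split_ifs <;> simp

/-- The linear map `a ↦ r⁻¹(a, -)` into the convolution dual. -/
def invConv : FRT C →ₗ[k] WithConv (FRT C →ₗ[k] k) :=
  (WithConv.linearEquiv k _).symm.toLinearMap ∘ₗ TensorProduct.curry (invForm hi h')

theorem invConv_mul (a b : FRT C) :
    invConv hi h' (a * b) = invConv hi h' b * invConv hi h' a := by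
  ext c
  simp only [invConv, LinearMap.comp_apply, LinearEquiv.coe_coe,
    WithConv.symm_linearEquiv_apply, TensorProduct.curry_apply, invForm_tmul, map_mul,
    form_mul_right, comul_flipInv, LinearMap.convMul_def]
  induction (Coalgebra.comul c : FRT C ⊗[k] FRT C) with
  | zero => simp
  | add x y hx hy => simp only [map_add, hx, hy]
  | tmul p q => simp [invForm_tmul]

theorem conv_mul_inv (a : FRT C) :
    LinearMap.mul' k _ (TensorProduct.map h.conv.toLinearMap (invConv hi h')
      (Coalgebra.comul a)) = Coalgebra.counit (R := k) a • 1 := by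
  have mulE : ∀ (X : FRT C ⊗[k] FRT C) (c : FRT C),
      LinearMap.mul' k _ (TensorProduct.map h.conv.toLinearMap (invConv hi h')
        (Coalgebra.comul c)) = Coalgebra.counit (R := k) c • 1 →
      LinearMap.mul' k _ (TensorProduct.map h.conv.toLinearMap (invConv hi h')
        (X * Coalgebra.comul c)) = Coalgebra.counit (R := k) c •
      LinearMap.mul' k _ (TensorProduct.map h.conv.toLinearMap (invConv hi h') X) := by
    intro X c hc
    induction X with
    | zero => simp
    | add x y hx hy => simp only [add_mul, map_add, hx, hy, smul_add]
    | tmul p q =>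
      have : ∀ Y : FRT C ⊗[k] FRT C,
          LinearMap.mul' k _ (TensorProduct.map h.conv.toLinearMap (invConv hi h')
            ((p ⊗ₜ q) * Y)) = h.conv p * LinearMap.mul' k _ (TensorProduct.map
              h.conv.toLinearMap (invConv hi h') Y) * invConv hi h' q := by
        intro Y
        induction Y with
        | zero => simp
        | add x y hx hy => simp only [mul_add, add_mul, map_add, hx, hy]
        | tmul y z => simp [invConv_mul, mul_assoc]
      rw [this, hc]
      simp
  induction a using FRT.induction with
  | h1 z =>
    have : invConv hi h' 1 = 1 := by
      ext c
      simp [invConv, invForm_tmul, LinearMap.convOne_def, form_one_right, counit_flipInv]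
    simp [Algebra.algebraMap_eq_smul_one, Algebra.TensorProduct.one_def, this]
  | ht i j =>
    ext b
    have := h.inv_t hi h' i j b
    simp only [FRT.comul_t, map_sum, TensorProduct.map_tmul, LinearMap.mul'_apply,
      AlgHom.toLinearMap_apply, conv_t, WithConv.ofConv_sum, LinearMap.sum_apply, FRT.counit_t]
    refine Eq.trans ?_ (this.trans ?_)
    · rfl
    · split_ifs <;> simp [LinearMap.convOne_def]
  | hadd x y hx hy => simp only [map_add, hx, hy, add_smul]
  | hmul x y hx hy => rw [Bialgebra.comul_mul, mulE _ _ hy, hx, Bialgebra.counit_mul, smul_smul,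
      mul_comm]

theorem form_mul_inv (a b : FRT C) :
    LinearMap.mul' k k (TensorProduct.map h.form (invForm hi h')
      (Coalgebra.comul (R := k) (a ⊗ₜ[k] b))) =
        Coalgebra.counit (R := k) a * Coalgebra.counit (R := k) b := by
  have e : ∀ X : FRT C ⊗[k] FRT C, LinearMap.mul' k k (TensorProduct.map h.form (invForm hi h')
      (TensorProduct.tensorTensorTensorComm k _ _ _ _ (X ⊗ₜ[k] Coalgebra.comul b))) =
      (LinearMap.mul' k _ (TensorProduct.map h.conv.toLinearMap (invConv hi h') X)).ofConv b := by
    intro X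
    induction X with
    | zero => simp
    | add x y hx hy => simp only [map_add, TensorProduct.add_tmul, hx, hy,
        WithConv.ofConv_add, LinearMap.add_apply]
    | tmul x y =>
      simp only [TensorProduct.map_tmul, LinearMap.mul'_apply, LinearMap.convMul_def,
        LinearMap.comp_apply]
      induction (Coalgebra.comul b : FRT C ⊗[k] FRT C) with
      | zero => simp
      | add x y hx hy => simp only [map_add, TensorProduct.tmul_add, hx, hy]
      | tmul p q => simp [form_tmul, invConv]
  refine (e _).trans ?_
  rw [conv_mul_inv]
  simp [LinearMap.convOne_def]

theorem isConvInverse_invForm : IsConvInverse h.form (invForm hi h') := by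
  constructor
  · ext a b
    simpa [mul_comm] using h.form_mul_inv hi h' a b
  · ext a b
    have key := h'.form_mul_inv (IsInverse.symm hi) h (flipInv hi b) (flipInv hi a)
    rw [counit_flipInv, counit_flipInv] at key
    have e : ∀ X Y : FRT C ⊗[k] FRT C,
        LinearMap.mul' k k (TensorProduct.map (invForm hi h') h.form
          (TensorProduct.tensorTensorTensorComm k _ _ _ _ (X ⊗ₜ[k] Y))) =
        LinearMap.mul' k k (TensorProduct.map h'.form (invForm (IsInverse.symm hi) h)
          (TensorProduct.tensorTensorTensorComm k _ _ _ _
            ((TensorProduct.map (flipInv hi).toLinearMap (flipInv hi).toLinearMap Y) ⊗ₜ[k]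
              (TensorProduct.map (flipInv hi).toLinearMap (flipInv hi).toLinearMap X)))) := by
      intro X Y
      induction X with
      | zero => simp
      | add x y hx hy => simp only [map_add, TensorProduct.add_tmul, TensorProduct.tmul_add,
          hx, hy]
      | tmul x y =>
        induction Y with
        | zero => simp
        | add x y hx hy => simp only [map_add, TensorProduct.add_tmul, TensorProduct.tmul_add,
            hx, hy]
        | tmul p q => simp [invForm_tmul, flipInv_flipInv]
    have e' := e (Coalgebra.comul a) (Coalgebra.comul b)
    rw [← comul_flipInv, ← comul_flipInv] at e'
    have := e'.trans key
    simp only [TensorProduct.AlgebraTensorModule.curry_apply, LinearMap.restrictScalars_self,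
      TensorProduct.curry_apply, LinearMap.comp_apply]
    refine Eq.trans this ?_
    simp

/-- `A(c)` is coquasitriangular. -/
theorem isCoquasitriangular_form {C' : Fin n → Fin n → Fin n → Fin n → k}
    (hi : IsInverse C C') (h' : YBCoeff C') : IsCoquasitriangular h.form where
  inv := ⟨_, h.isConvInverse_invForm hi h'⟩
  mul_left := h.form_mul_left
  mul_right := h.form_mul_right
  comm := h.form_comm

end YBCoeff

end UniversalForm

/-! ### The data attached to a braided vector space with a basis -/

section BraidedData

variable {k : Type u} [Field k] {V : Type v} [AddCommGroup V] [Module k V] {n : ℕ}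
  (x : Module.Basis (Fin n) k V) (c : V ⊗[k] V ≃ₗ[k] V ⊗[k] V)

theorem braiding_apply (i j : Fin n) :
    c (x i ⊗ₜ x j) = ∑ a, ∑ b, coeff x c i j a b • (x a ⊗ₜ[k] x b) := by
  have := (x.tensorProduct x).sum_repr (c (x i ⊗ₜ x j))
  rw [← this, Fintype.sum_prod_type]
  simp [coeff]

theorem isInverse_coeff : YBCoeff.IsInverse (coeff x c) (coeff x c.symm) := by
  intro i j r s
  have h : c.symm (c (x i ⊗ₜ x j)) = x i ⊗ₜ x j := c.symm_apply_apply _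
  rw [braiding_apply] at h
  simp only [map_sum, map_smul] at h
  have h' := congrArg (fun z => (x.tensorProduct x).repr z (r, s)) h
  simpa [coeff, Finsupp.single_apply, Finsupp.finsetSum_apply, ← ite_and, and_comm, eq_comm]
    using h'

variable {c}

theorem IsBraiding.symm (hc : IsBraiding c) : IsBraiding c.symm := by
  let c₁ : (V ⊗[k] V) ⊗[k] V ≃ₗ[k] (V ⊗[k] V) ⊗[k] V :=
    TensorProduct.congr c (LinearEquiv.refl k V)
  let c₂ : (V ⊗[k] V) ⊗[k] V ≃ₗ[k] (V ⊗[k] V) ⊗[k] V :=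
    (TensorProduct.assoc k V V V) ≪≫ₗ TensorProduct.congr (LinearEquiv.refl k V) c ≪≫ₗ
      (TensorProduct.assoc k V V V).symm
  have h : ∀ z, c₁ (c₂ (c₁ z)) = c₂ (c₁ (c₂ z)) := fun z => LinearMap.congr_fun hc z
  refine LinearMap.ext fun z => ?_
  change c₁.symm (c₂.symm (c₁.symm z)) = c₂.symm (c₁.symm (c₂.symm z))
  apply c₁.injective
  apply c₂.injective
  apply c₁.injective
  rw [h (c₂.symm _)]
  simp

theorem IsBraiding.ybCoeff (hc : IsBraiding c) : YBCoeff (coeff x c) := by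
  intro i j q p r s
  unfold IsBraiding at hc
  have h := congrArg (fun f => ((x.tensorProduct x).tensorProduct x).repr
    (f ((x i ⊗ₜ x j) ⊗ₜ x q)) ((p, r), s)) hc
  simp only [LinearMap.comp_apply, TensorProduct.map_tmul, LinearEquiv.coe_coe, braiding_apply x,
    LinearMap.id_apply, TensorProduct.sum_tmul, TensorProduct.tmul_sum, map_sum, map_smul,
    TensorProduct.assoc_tmul, TensorProduct.assoc_symm_tmul, TensorProduct.tmul_smul,
    ← TensorProduct.smul_tmul', Finset.smul_sum, smul_smul, Finsupp.finsetSum_apply,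
    Finsupp.smul_apply, Module.Basis.tensorProduct_repr_tmul_apply, Module.Basis.repr_self,
    smul_eq_mul, Finsupp.single_apply] at h
  simp only [mul_ite, mul_one, mul_zero, Finset.sum_ite_eq', Finset.mem_univ, if_true,
    Finset.sum_ite_irrel, Finset.sum_const_zero] at h
  rw [h]
  rw [Finset.sum_comm, Finset.sum_congr rfl fun _ _ => Finset.sum_comm, Finset.sum_comm]

/-- The automorphism `𝔍_g(a) = r(a₁, g) a₂ r⁻¹(a₃, g)` of `A(c)`. -/
def hayashiMap (hc : IsBraiding c) (g : FRT (coeff x c)) :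
    FRT (coeff x c) →ₗ[k] FRT (coeff x c) :=
  conjBy (hc.ybCoeff x).form
    (YBCoeff.invForm (isInverse_coeff x c) (hc.symm.ybCoeff x)) g

/-- The coaction `λ(xᵢ) = ∑ⱼ t_i^j ⊗ xⱼ` of `A(c)` on `V`. -/
def FRT.coaction (C : Fin n → Fin n → Fin n → Fin n → k) : V →ₗ[k] FRT C ⊗[k] V :=
  x.constr k (fun i => ∑ j, FRT.t C i j ⊗ₜ[k] x j)

/-- The coaction `λ(xᵢ) = ∑ⱼ t_i^j ⊗ xⱼ` of `𝓗(c)` on `V`. -/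
def Schauenburg.coaction (C : Fin n → Fin n → Fin n → Fin n → k) :
    V →ₗ[k] Schauenburg C ⊗[k] V :=
  x.constr k (fun i => ∑ j, Schauenburg.t C i j ⊗ₜ[k] x j)

end BraidedData

/-! ### Weakly graded-Frobenius algebras and the quantum determinant -/

section WGF

/-- A weakly graded-Frobenius algebra structure on the algebra `B`, for a bialgebra `A` and an
`A`-comodule `(V, ρ)`. -/
structure WGF {k : Type u} [Field k] {A : Type u} [Ring A] [Bialgebra k A] {V : Type v}
    [AddCommGroup V] [Module k V] (ρ : V →ₗ[k] A ⊗[k] V)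
    (B : Type w) [Ring B] [Algebra k B] where
  /-- the coaction, an algebra map -/
  coact : B →ₐ[k] A ⊗[k] B
  isLeftCoaction : IsLeftCoaction coact.toLinearMap
  /-- the homogeneous components -/
  gr : ℕ → Submodule k B
  gradedMonoid : SetLike.GradedMonoid gr
  isInternal : DirectSum.IsInternal gr
  coact_mem : ∀ m, ∀ b ∈ gr m,
    coact b ∈ LinearMap.range (TensorProduct.map (LinearMap.id : A →ₗ[k] A) (gr m).subtype)
  gr_zero : gr 0 = 1
  /-- the identification of `V` with the degree one component, as comodules -/
  incl : V →ₗ[k] B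
  incl_injective : Function.Injective incl
  range_incl : LinearMap.range incl = gr 1
  coact_incl : ∀ v, coact (incl v) = TensorProduct.map LinearMap.id incl (ρ v)
  finite : Module.Finite k B
  /-- the top degree -/
  top : ℕ
  isGreatest_top : IsGreatest {m | gr m ≠ ⊥} top
  finrank_top : Module.finrank k (gr top) = 1
  /-- the pairings `B¹ × B^{top-1} → B^{top}` and `B^{top-1} × B¹ → B^{top}` are nondegenerate -/
  nondeg : ∀ m, m + 1 = top →
    (∀ a ∈ gr 1, (∀ b ∈ gr m, a * b = 0) → a = 0) ∧
    (∀ b ∈ gr m, (∀ a ∈ gr 1, a * b = 0) → b = 0) ∧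
    (∀ b ∈ gr m, (∀ a ∈ gr 1, b * a = 0) → b = 0) ∧
    (∀ a ∈ gr 1, (∀ b ∈ gr m, b * a = 0) → a = 0)

namespace WGF

variable {k : Type u} [Field k] {A : Type u} [Ring A] [Bialgebra k A] {V : Type v}
    [AddCommGroup V] [Module k V] {ρ : V →ₗ[k] A ⊗[k] V}
    {B : Type w} [Ring B] [Algebra k B] (W : WGF ρ B)

theorem exists_qdet : ∃ D : GroupLike k A, ∀ b ∈ W.gr W.top, W.coact b = D.val ⊗ₜ[k] b := by
  obtain ⟨⟨b, hb⟩, hb0, hspan⟩ := finrank_eq_one_iff'.1 W.finrank_top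
  have hb0' : b ≠ 0 := fun h => hb0 (by ext; exact h)
  obtain ⟨D, hD⟩ : ∃ D : A, W.coact b = D ⊗ₜ[k] b := by
    obtain ⟨z, hz⟩ := W.coact_mem _ b hb
    rw [← hz]
    clear hz
    induction z with
    | zero => exact ⟨0, by simp⟩
    | tmul a y =>
      obtain ⟨r, hr⟩ := hspan y
      refine ⟨r • a, ?_⟩
      rw [← hr]
      simp [TensorProduct.smul_tmul]
    | add y z hy hz =>
      obtain ⟨D, hD⟩ := hy
      obtain ⟨D', hD'⟩ := hz
      exact ⟨D + D', by rw [map_add, hD, hD', TensorProduct.add_tmul]⟩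
  obtain ⟨φ, hφ⟩ : ∃ φ : B →ₗ[k] k, φ b = 1 := by
    by_contra! hcon
    refine hb0' ((Module.forall_dual_apply_eq_zero_iff k b).1 fun φ => ?_)
    by_contra hφ
    exact hcon ((φ b)⁻¹ • φ) (by simp [hφ])
  refine ⟨⟨D, ?_, ?_⟩, fun b' hb' => ?_⟩
  · have := congrArg φ (W.isLeftCoaction.counit b)
    simpa [hD, hφ] using this
  · have := congrArg (TensorProduct.assoc k A A B).symm (W.isLeftCoaction.coassoc b)
    have h' := congrArg (fun z => TensorProduct.rid k _ (TensorProduct.map LinearMap.id φ z)) this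
    simpa [hD, hφ] using h'
  · obtain ⟨r, hr⟩ := hspan ⟨b', hb'⟩
    have hr' : r • b = b' := congrArg Subtype.val hr
    rw [← hr', map_smul, hD]
    simp

/-- The quantum determinant: the group-like element `D` with `λ(b) = D ⊗ b` for `b ∈ B^{top}`. -/
def qdet : GroupLike k A := W.exists_qdet.choose

theorem coact_top {b : B} (hb : b ∈ W.gr W.top) : W.coact b = W.qdet.val ⊗ₜ[k] b :=
  W.exists_qdet.choose_spec b hb

end WGF

end WGF

end

/-! Everything rests on one fact: over `A(c)[D⁻¹]` the matrix `t` is invertible. Applying the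
coaction to `xᵢ ωʲ = δ 𝔟` gives the Laplace expansion `∑ t_i^k T_k^j = δ D`
(`WGF.sum_t_mul_cofactor`), so `T D⁻¹` is a right inverse. The assumption on `𝔍(T)` makes `D⁻¹ 𝔍(T)`
a left inverse. The two coincide, and `𝔍` plays no further role.

The isomorphism with `𝓗(c)` (`Loc.equivSchauenburg`) compares two ways of inverting. Since `t` has
an inverse over `A(c)[D⁻¹]`, there is a map out of `𝓗(c)`. Conversely, `t ↦ u` extends to an
antihomomorphism `A(c) → 𝓗(c)` that is convolution inverse to the canonical map. On the group-like
`D` this says that the image of `D` is invertible, so the canonical map factors through `A(c)[D⁻¹]`.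
Inverses are unique, so algebra maps out of either algebra are determined by the images of the
`t_i^j`. The same antihomomorphism principle, applied to `T D⁻¹`, gives the antipode of `A(c)[D⁻¹]`,
with `D⁻¹ ↦ D`.

The form `r` is extended from `A(c)` to `A(c)[D⁻¹]` one variable at a time. In the second variable,
`b ↦ r(t_i^j, b)` is the entry of a matrix representation, and it extends because `r(t_i^j, D)` is
an invertible matrix. In the first variable, `a ↦ r(a, -)` is an algebra map to the convolution
dual, and it extends because the character `r(D, -)` has a convolution inverse, obtained by
composing it with the antipode. The commutation axiom says that a fixed element intertwines two
algebra maps. By `Loc.intertwine` it suffices to check such a statement on the `t_i^j`, where it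
becomes the FRT relation. The form on `𝓗(c)` is then the pullback along the isomorphism.

For universality, the matrix coefficients of a coaction inducing `c` satisfy the FRT relations by
the commutation axiom, and the antipode of `L` inverts their matrix. This defines the map `f`. It is
unique because the images of the `t_i^j` are prescribed, and it preserves the forms because a
bialgebra pairing on `𝓗(c)` is determined by its values on pairs of `t`'s (`Schauenburg.form_ext`).
-/

noncomputable section

/-! ### Inverses of matrices over a noncommutative algebra -/

section InverseMatrix

variable {B : Type w} [Semiring B] {n : ℕ}

theorem left_inv_eq_right_inv_of_sum {f g g' : Fin n → Fin n → B}
    (hgf : ∀ i j, ∑ a, g i a * f a j = if i = j then 1 else 0)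
    (hfg : ∀ i j, ∑ a, f i a * g' a j = if i = j then 1 else 0) : g = g' := by
  have h₁ : Matrix.of g * Matrix.of f = 1 := by
    ext i j; simpa [Matrix.mul_apply, Matrix.one_apply] using hgf i j
  have h₂ : Matrix.of f * Matrix.of g' = 1 := by
    ext i j; simpa [Matrix.mul_apply, Matrix.one_apply] using hfg i j
  exact Matrix.of.injective (left_inv_eq_right_inv h₁ h₂)

/-- The inverse of a matrix satisfying the FRT relations satisfies them in the opposite algebra. -/
theorem FRT.op_rel {k : Type u} [Field k] [Algebra k B] {C : Fin n → Fin n → Fin n → Fin n → k}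
    {f g : Fin n → Fin n → B}
    (hf : ∀ i j r s, ∑ a, ∑ b, C i j a b • (f a r * f b s) =
      ∑ a, ∑ b, C a b r s • (f i a * f j b))
    (hgf : ∀ i j, ∑ a, g i a * f a j = if i = j then 1 else 0)
    (hfg : ∀ i j, ∑ a, f i a * g a j = if i = j then 1 else 0) (i j r s : Fin n) :
    ∑ a, ∑ b, C i j a b • (MulOpposite.op (g a r) * MulOpposite.op (g b s)) =
      ∑ a, ∑ b, C a b r s • (MulOpposite.op (g i a) * MulOpposite.op (g j b)) := by
  let M : Matrix (Fin n × Fin n) (Fin n × Fin n) B := Matrix.of fun p q =>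
    algebraMap k B (C p.1 p.2 q.1 q.2)
  let F : Matrix (Fin n × Fin n) (Fin n × Fin n) B := Matrix.of fun p q => f p.1 q.1 * f p.2 q.2
  -- `F` is the tensor square of `f`. Over a noncommutative algebra its inverse has the factors `g`
  -- in reversed order, so the entries of `G` are products in the opposite algebra.
  let G : Matrix (Fin n × Fin n) (Fin n × Fin n) B := Matrix.of fun p q => g p.2 q.2 * g p.1 q.1
  have hM : M * F = F * M := by
    ext p q
    have := hf p.1 p.2 q.1 q.2
    simp only [Algebra.smul_def] at this
    simp only [Matrix.mul_apply, M, F, Fintype.sum_prod_type, Matrix.of_apply]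
    exact this.trans (Finset.sum_congr rfl fun _ _ => Finset.sum_congr rfl fun _ _ =>
      Algebra.commutes _ _)
  have hFG : F * G = 1 := by
    ext ⟨p, p'⟩ ⟨q, q'⟩
    simp only [Matrix.mul_apply, F, G, Fintype.sum_prod_type, Matrix.of_apply, Matrix.one_apply,
      Prod.mk.injEq]
    have : ∀ a, ∑ b, f p a * f p' b * (g b q' * g a q) =
        f p a * (∑ b, f p' b * g b q') * g a q := fun a => by
      simp only [Finset.mul_sum, Finset.sum_mul, mul_assoc]
    simp only [this, hfg]
    by_cases h : p' = q' <;> simp [h, hfg]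
  have hGF : G * F = 1 := by
    ext ⟨p, p'⟩ ⟨q, q'⟩
    simp only [Matrix.mul_apply, F, G, Fintype.sum_prod_type, Matrix.of_apply, Matrix.one_apply,
      Prod.mk.injEq]
    rw [Finset.sum_comm]
    have : ∀ a, ∑ b, g p' a * g p b * (f b q * f a q') =
        g p' a * (∑ b, g p b * f b q) * f a q' := fun a => by
      simp only [Finset.mul_sum, Finset.sum_mul, mul_assoc]
    simp only [this, hgf]
    by_cases h : p = q <;> simp [h, hgf]
  -- The FRT relations say that `M` commutes with `F`; hence `M` commutes with the inverse of `F`.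
  have key : G * M = M * G := by
    calc G * M = G * (M * F) * G := by rw [mul_assoc, mul_assoc, hFG, mul_one]
      _ = M * G := by rw [hM, ← mul_assoc, hGF, one_mul]
  have := congrFun (congrFun key (i, j)) (r, s)
  simp only [Matrix.mul_apply, M, G, Fintype.sum_prod_type, Matrix.of_apply] at this
  apply MulOpposite.unop_injective
  simp only [Finset.unop_sum, MulOpposite.unop_smul, MulOpposite.unop_mul,
    MulOpposite.unop_op]
  simp only [Algebra.smul_def]
  exact this.symm.trans (Finset.sum_congr rfl fun _ _ => Finset.sum_congr rfl fun _ _ =>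
    (Algebra.commutes _ _).symm)

end InverseMatrix

/-! ### Antihomomorphisms as convolution inverses of algebra maps -/

section AntiHom

variable {k : Type u} [Field k] {K : Type v} [Ring K] [Bialgebra k K] {B : Type w} [Ring B]
  [Algebra k B]

/-- The linear map underlying an algebra map to the opposite algebra. -/
def antiLin (S : K →ₐ[k] Bᵐᵒᵖ) : K →ₗ[k] B :=
  (MulOpposite.opLinearEquiv k).symm.toLinearMap ∘ₗ S.toLinearMap

@[simp] theorem antiLin_apply (S : K →ₐ[k] Bᵐᵒᵖ) (a : K) : antiLin S a = (S a).unop := rfl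

/-- `S` is convolution inverse to `F` at the element `a`. -/
def ConvInvAt (S : K →ₐ[k] Bᵐᵒᵖ) (F : K →ₐ[k] B) (a : K) : Prop :=
  LinearMap.mul' k B (TensorProduct.map (antiLin S) F.toLinearMap (Coalgebra.comul a)) =
      algebraMap k B (Coalgebra.counit a) ∧
    LinearMap.mul' k B (TensorProduct.map F.toLinearMap (antiLin S) (Coalgebra.comul a)) =
      algebraMap k B (Coalgebra.counit a)

variable {S : K →ₐ[k] Bᵐᵒᵖ} {F : K →ₐ[k] B}

theorem ConvInvAt.of_algebraMap (z : k) : ConvInvAt S F (algebraMap k K z) := by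
  constructor <;> simp [Algebra.algebraMap_eq_smul_one, Algebra.TensorProduct.one_def]

theorem ConvInvAt.add {a b : K} (ha : ConvInvAt S F a) (hb : ConvInvAt S F b) :
    ConvInvAt S F (a + b) := by
  constructor <;> simp only [map_add, ha.1, hb.1, ha.2, hb.2]

/-- With scalars and sums, this makes the elements at which `S` inverts `F` a subalgebra, so that
antipodes need checking only on generators. -/
theorem ConvInvAt.mul {a b : K} (ha : ConvInvAt S F a) (hb : ConvInvAt S F b) :
    ConvInvAt S F (a * b) := by
  -- Since `S(a₁b₁)F(a₂b₂) = S(b₁) (S(a₁)F(a₂)) F(b₂)`, the inner factor has to be a scalar before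
  -- it can be pulled out. In the mirror image `e₂` the inner factor is the one belonging to `b`, so
  -- there the condition falls on `Y`.
  have e₁ : ∀ X Y : K ⊗[k] K, LinearMap.mul' k B (TensorProduct.map (antiLin S) F.toLinearMap X) ∈
      Set.range (algebraMap k B) →
      LinearMap.mul' k B (TensorProduct.map (antiLin S) F.toLinearMap (X * Y)) =
      LinearMap.mul' k B (TensorProduct.map (antiLin S) F.toLinearMap X) *
        LinearMap.mul' k B (TensorProduct.map (antiLin S) F.toLinearMap Y) := by
    rintro X Y ⟨z, hz⟩
    induction Y with
    | zero => simp
    | add x y hx hy => simp only [mul_add, map_add, hx, hy]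
    | tmul p q =>
      have : LinearMap.mul' k B (TensorProduct.map (antiLin S) F.toLinearMap (X * (p ⊗ₜ q))) =
          antiLin S p * LinearMap.mul' k B (TensorProduct.map (antiLin S) F.toLinearMap X) *
            F q := by
        clear hz
        induction X with
        | zero => simp
        | add x y hx hy => simp only [add_mul, mul_add, map_add, hx, hy]
        | tmul x y => simp [mul_assoc]
      rw [this, ← hz, ← Algebra.commutes, mul_assoc]
      simp
  have e₂ : ∀ X Y : K ⊗[k] K, LinearMap.mul' k B (TensorProduct.map F.toLinearMap (antiLin S) Y) ∈
      Set.range (algebraMap k B) →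
      LinearMap.mul' k B (TensorProduct.map F.toLinearMap (antiLin S) (X * Y)) =
      LinearMap.mul' k B (TensorProduct.map F.toLinearMap (antiLin S) X) *
        LinearMap.mul' k B (TensorProduct.map F.toLinearMap (antiLin S) Y) := by
    rintro X Y ⟨z, hz⟩
    induction X with
    | zero => simp
    | add x y hx hy => simp only [add_mul, map_add, hx, hy]
    | tmul p q =>
      have : LinearMap.mul' k B (TensorProduct.map F.toLinearMap (antiLin S) ((p ⊗ₜ q) * Y)) =
          F p * LinearMap.mul' k B (TensorProduct.map F.toLinearMap (antiLin S) Y) *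
            antiLin S q := by
        clear hz
        induction Y with
        | zero => simp
        | add x y hx hy => simp only [add_mul, mul_add, map_add, hx, hy]
        | tmul x y => simp [mul_assoc]
      rw [this, ← hz, mul_assoc, Algebra.commutes, ← mul_assoc]
      simp
  constructor
  · rw [Bialgebra.comul_mul, e₁ _ _ ⟨_, ha.1.symm⟩, ha.1, hb.1, Bialgebra.counit_mul, map_mul]
  · rw [Bialgebra.comul_mul, e₂ _ _ ⟨_, hb.2.symm⟩, ha.2, hb.2, Bialgebra.counit_mul, map_mul]

theorem ConvInvAt.of_groupLike {a : K} (ha : IsGroupLikeElem k a) (h₁ : antiLin S a * F a = 1)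
    (h₂ : F a * antiLin S a = 1) : ConvInvAt S F a := by
  constructor <;> simp only [ha.comul_eq_tmul_self, ha.counit_eq_one, TensorProduct.map_tmul,
    LinearMap.mul'_apply, AlgHom.toLinearMap_apply, h₁, h₂, map_one]

/-- With `Δ(a) = a ⊗ a` and `ε(a) = 1`, convolution inversion becomes inversion of the element
`F(a)`. This is how the quantum determinant becomes invertible as soon as the matrix `t` is. -/
theorem ConvInvAt.groupLike {a : K} (h : ConvInvAt S F a) (ha : IsGroupLikeElem k a) :
    antiLin S a * F a = 1 ∧ F a * antiLin S a = 1 := by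
  have h₁ := h.1
  have h₂ := h.2
  simp only [ha.comul_eq_tmul_self, ha.counit_eq_one, TensorProduct.map_tmul,
    LinearMap.mul'_apply, AlgHom.toLinearMap_apply, map_one] at h₁ h₂
  exact ⟨h₁, h₂⟩

theorem isAntipode_antiLin {S : K →ₐ[k] Kᵐᵒᵖ} (h : ∀ a, ConvInvAt S (AlgHom.id k K) a) :
    IsAntipode (antiLin S) :=
  ⟨LinearMap.ext fun a => (h a).1, LinearMap.ext fun a => (h a).2⟩

end AntiHom

/-! ### Antihomomorphisms out of `A(c)` -/

namespace FRT

variable {k : Type u} [Field k] {n : ℕ} {C : Fin n → Fin n → Fin n → Fin n → k}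
  {B : Type w} [Ring B] [Algebra k B] {f g : Fin n → Fin n → B}
  (hf : ∀ i j r s, ∑ a, ∑ b, C i j a b • (f a r * f b s) = ∑ a, ∑ b, C a b r s • (f i a * f j b))
  (hgf : ∀ i j, ∑ a, g i a * f a j = if i = j then 1 else 0)
  (hfg : ∀ i j, ∑ a, f i a * g a j = if i = j then 1 else 0)

/-- The algebra map `A(c) → Bᵒᵖ` given by the inverse of a matrix satisfying the FRT relations. -/
def liftOp : FRT C →ₐ[k] Bᵐᵒᵖ :=
  lift (fun i j => MulOpposite.op (g i j)) (op_rel hf hgf hfg)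

@[simp] theorem liftOp_t (i j : Fin n) : liftOp hf hgf hfg (t C i j) = MulOpposite.op (g i j) :=
  lift_t _ _ i j

theorem convInvAt_liftOp (a : FRT C) : ConvInvAt (liftOp hf hgf hfg) (lift f hf) a := by
  induction a using FRT.induction with
  | h1 z => exact .of_algebraMap z
  | hmul a b ha hb => exact ha.mul hb
  | hadd a b ha hb => exact ha.add hb
  | ht i j =>
    constructor
    · simp only [comul_t, map_sum, TensorProduct.map_tmul, LinearMap.mul'_apply, antiLin_apply,
        liftOp_t, MulOpposite.unop_op, AlgHom.toLinearMap_apply, lift_t, hgf, counit_t]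
      split_ifs <;> simp
    · simp only [comul_t, map_sum, TensorProduct.map_tmul, LinearMap.mul'_apply, antiLin_apply,
        liftOp_t, MulOpposite.unop_op, AlgHom.toLinearMap_apply, lift_t, hfg, counit_t]
      split_ifs <;> simp

end FRT

/-! ### The canonical map from `A(c)` to `𝓗(c)` -/

namespace Schauenburg

variable {k : Type u} [Field k] {n : ℕ} {C : Fin n → Fin n → Fin n → Fin n → k}

/-- The images of the `u_i^j` form the inverse of the matrix of the images of the `t_i^j`, and
inverses are unique. -/
theorem algHom_ext_t {B : Type w} [Semiring B] [Algebra k B] {f g : Schauenburg C →ₐ[k] B}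
    (h : ∀ i j, f (t C i j) = g (t C i j)) : f = g := by
  refine algHom_ext h fun i j => ?_
  have h₁ : ∀ i j, ∑ a, f (u C i a) * f (t C a j) = if i = j then 1 else 0 := fun i j => by
    have := congrArg f (u_mul_t (C := C) i j)
    simpa [apply_ite f] using this
  have h₂ : ∀ i j, ∑ a, f (t C i a) * g (u C a j) = if i = j then 1 else 0 := fun i j => by
    have := congrArg g (t_mul_u (C := C) i j)
    simpa [apply_ite g, h] using this
  exact congrFun (congrFun (left_inv_eq_right_inv_of_sum (f := fun i j => f (t C i j)) h₁ h₂) i) j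

variable (C) in
/-- The canonical map `A(c) → 𝓗(c)`. -/
def ι : FRT C →ₐ[k] Schauenburg C := FRT.lift (t C) t_rel

@[simp] theorem ι_t (i j : Fin n) : ι C (FRT.t C i j) = t C i j := FRT.lift_t _ _ i j

variable (C) in
/-- The algebra map `A(c) → 𝓗(c)ᵒᵖ`, `t_i^j ↦ u_i^j`. -/
def ιOp : FRT C →ₐ[k] (Schauenburg C)ᵐᵒᵖ := FRT.liftOp t_rel u_mul_t t_mul_u

theorem convInvAt_ι (a : FRT C) : ConvInvAt (ιOp C) (ι C) a := FRT.convInvAt_liftOp _ _ _ a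

end Schauenburg

/-! ### Antipode of `A(c)[D⁻¹]` and its isomorphism with `𝓗(c)` -/

namespace Loc

variable {k : Type u} [Field k] {n : ℕ} {C : Fin n → Fin n → Fin n → Fin n → k}
  {D : GroupLike k (FRT C)}

theorem induction {P : Loc D → Prop} (h1 : ∀ z : k, P (algebraMap k _ z))
    (ht : ∀ i j, P (ι D (FRT.t C i j))) (hinv : P (inv D))
    (hmul : ∀ a b, P a → P b → P (a * b)) (hadd : ∀ a b, P a → P b → P (a + b))
    (a : Loc D) : P a := by
  obtain ⟨p, rfl⟩ : ∃ p, mk D p = a := RingQuot.mkAlgHom_surjective k (LocRel D.val) a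
  induction p using FreeAlgebra.induction with
  | grade0 z => simpa using h1 z
  | grade1 q =>
    rcases q with _ | q
    · exact hinv
    · have := ht q.1 q.2
      simpa only [ι, FRT.lift_t] using this
  | mul a b ha hb => simpa using hmul _ _ ha hb
  | add a b ha hb => simpa using hadd _ _ ha hb

/-- An element that intertwines two algebra maps on the generators `t_i^j` intertwines them. -/
theorem intertwine {B : Type w} [Semiring B] [Algebra k B] (f g : Loc D →ₐ[k] B) (X : B)
    (h : ∀ i j, X * f (ι D (FRT.t C i j)) = g (ι D (FRT.t C i j)) * X) (a : Loc D) :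
    X * f a = g a * X := by
  have hA : ∀ a, X * f (ι D a) = g (ι D a) * X := by
    intro a
    induction a using FRT.induction with
    | h1 z => simpa using (Algebra.commutes z X).symm
    | ht i j => exact h i j
    | hmul a b ha hb => rw [map_mul, map_mul, map_mul, ← mul_assoc, ha, mul_assoc, hb, mul_assoc]
    | hadd a b ha hb => simp only [map_add, mul_add, add_mul, ha, hb]
  induction a using Loc.induction with
  | h1 z => simpa using (Algebra.commutes z X).symm
  | ht i j => exact h i j
  | hmul a b ha hb => rw [map_mul, map_mul, ← mul_assoc, ha, mul_assoc, hb, mul_assoc]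
  | hadd a b ha hb => simp only [map_add, mul_add, add_mul, ha, hb]
  -- The relation `X f(D) = g(D) X` is multiplied by `g(D⁻¹)` on the left and by `f(D⁻¹)` on the
  -- right.
  | hinv =>
    calc X * f (inv D) = g (inv D * ι D D.val) * (X * f (inv D)) := by
          rw [inv_mul_ι, map_one, one_mul]
      _ = g (inv D) * (X * f (ι D D.val)) * f (inv D) := by
          rw [map_mul, hA]; simp only [mul_assoc]
      _ = g (inv D) * X * f (ι D D.val * inv D) := by rw [map_mul]; simp only [mul_assoc]
      _ = g (inv D) * X := by rw [ι_mul_inv, map_one, mul_one]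

theorem algHom_ext_t {B : Type w} [Semiring B] [Algebra k B] {f g : Loc D →ₐ[k] B}
    (h : ∀ i j, f (ι D (FRT.t C i j)) = g (ι D (FRT.t C i j))) : f = g :=
  AlgHom.ext fun a => by
    simpa using intertwine f g 1 (fun i j => by rw [one_mul, mul_one, h]) a

theorem t_rel (i j r s : Fin n) :
    ∑ a, ∑ b, C i j a b • (ι D (FRT.t C a r) * ι D (FRT.t C b s)) =
      ∑ a, ∑ b, C a b r s • (ι D (FRT.t C i a) * ι D (FRT.t C j b)) := by
  simpa using congrArg (ι D) (FRT.t_rel (C := C) i j r s)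

theorem lift_t_rel : FRT.lift (fun i j => ι D (FRT.t C i j)) t_rel = ι D :=
  FRT.algHom_ext fun i j => by simp

section Antipode

variable {g : Fin n → Fin n → Loc D}
  (hg : ∀ i j, ∑ a, g i a * ι D (FRT.t C a j) = if i = j then 1 else 0)
  (hg' : ∀ i j, ∑ a, ι D (FRT.t C i a) * g a j = if i = j then 1 else 0)

theorem convInvAt_ι (a : FRT C) : ConvInvAt (FRT.liftOp t_rel hg hg') (ι D) a := by
  have := FRT.convInvAt_liftOp t_rel hg hg' a
  rwa [lift_t_rel] at this

/-- `D` is group-like, so its image under the antihomomorphism inverts `D`, and inverses are unique.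
This forces the antipode to send `D⁻¹` back to `D`. -/
theorem unop_liftOp_qdet : (FRT.liftOp t_rel hg hg' D.val).unop = inv D :=
  left_inv_eq_right_inv ((convInvAt_ι hg hg' D.val).groupLike D.isGroupLikeElem_val).1 (ι_mul_inv D)

/-- The antipode of `A(c)[D⁻¹]` given by an inverse of the matrix of the `t_i^j`. -/
def antipodeOp : Loc D →ₐ[k] (Loc D)ᵐᵒᵖ :=
  lift (FRT.liftOp t_rel hg hg') (MulOpposite.op (ι D D.val))
    (MulOpposite.unop_injective (by simp [unop_liftOp_qdet, ι_mul_inv]))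
    (MulOpposite.unop_injective (by simp [unop_liftOp_qdet, inv_mul_ι]))

@[simp] theorem antipodeOp_t (i j : Fin n) :
    antipodeOp hg hg' (ι D (FRT.t C i j)) = MulOpposite.op (g i j) := by
  simp [antipodeOp]

theorem convInvAt_antipodeOp (a : Loc D) :
    ConvInvAt (antipodeOp hg hg') (AlgHom.id k (Loc D)) a := by
  induction a using Loc.induction with
  | h1 z => exact .of_algebraMap z
  | hmul a b ha hb => exact ha.mul hb
  | hadd a b ha hb => exact ha.add hb
  | ht i j =>
    constructor
    · simp only [comul_ι, FRT.comul_t, map_sum, TensorProduct.map_tmul, LinearMap.mul'_apply,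
        antiLin_apply, AlgHom.toLinearMap_apply, antipodeOp_t, MulOpposite.unop_op,
        AlgHom.id_apply, hg, counit_ι, FRT.counit_t]
      split_ifs <;> simp
    · simp only [comul_ι, FRT.comul_t, map_sum, TensorProduct.map_tmul, LinearMap.mul'_apply,
        antiLin_apply, AlgHom.toLinearMap_apply, antipodeOp_t, MulOpposite.unop_op,
        AlgHom.id_apply, hg', counit_ι, FRT.counit_t]
      split_ifs <;> simp
  | hinv =>
    exact .of_groupLike ⟨by simp, by simp⟩ (by simp [antipodeOp, ι_mul_inv])
      (by simp [antipodeOp, inv_mul_ι])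

/-- If the matrix of the `t_i^j` is invertible over `A(c)[D⁻¹]`, then `𝓗(c) = A(c)[D⁻¹]`. -/
def equivSchauenburg : Schauenburg C ≃ₐc[k] Loc D :=
  BialgEquiv.ofAlgEquiv
    (AlgEquiv.ofAlgHom (Schauenburg.lift (fun i j => ι D (FRT.t C i j)) g t_rel hg hg')
      -- The inverse of `D` in `𝓗(c)` is the image of `D` under the antihomomorphism `t ↦ u`.
      (lift (Schauenburg.ι C) (antiLin (Schauenburg.ιOp C) D.val)
        ((Schauenburg.convInvAt_ι D.val).groupLike D.isGroupLikeElem_val).2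
        ((Schauenburg.convInvAt_ι D.val).groupLike D.isGroupLikeElem_val).1)
      (algHom_ext_t fun i j => by rw [AlgHom.comp_apply, lift_ι]; simp)
      (Schauenburg.algHom_ext_t fun i j => by
        rw [AlgHom.comp_apply, Schauenburg.lift_t, lift_ι]; simp))
    (Schauenburg.algHom_ext_t fun i j => by simp)
    (Schauenburg.algHom_ext_t fun i j => by simp)

@[simp] theorem equivSchauenburg_t (i j : Fin n) :
    equivSchauenburg hg hg' (Schauenburg.t C i j) = ι D (FRT.t C i j) :=
  Schauenburg.lift_t _ _ _ _ _ i j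

@[simp] theorem equivSchauenburg_u (i j : Fin n) :
    equivSchauenburg hg hg' (Schauenburg.u C i j) = g i j :=
  Schauenburg.lift_u _ _ _ _ _ i j

end Antipode

end Loc

/-! ### Pairings given by algebra maps to a convolution dual -/

section Pairing

variable {k : Type u} [Field k]

section

variable {K : Type v} [Ring K] [Bialgebra k K] {L : Type w} [Ring L] [Bialgebra k L]
  (Q : K →ₐ[k] WithConv (L →ₗ[k] k))

/-- The pairing given by an algebra map to a convolution algebra. -/
def pairing : K ⊗[k] L →ₗ[k] k :=
  TensorProduct.lift ((WithConv.linearEquiv k _).toLinearMap ∘ₗ Q.toLinearMap)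

theorem pairing_tmul (a : K) (b : L) : pairing Q (a ⊗ₜ b) = (Q a).ofConv b := by
  simp [pairing]

theorem curry_pairing (a : K) : TensorProduct.curry (pairing Q) a = (Q a).ofConv := by
  ext b; simp [pairing_tmul]

theorem pairing_mul_left (a b : K) (c : L) : pairing Q ((a * b) ⊗ₜ c) =
    LinearMap.mul' k k (TensorProduct.map (TensorProduct.curry (pairing Q) a)
      (TensorProduct.curry (pairing Q) b) (Coalgebra.comul c)) := by
  rw [pairing_tmul, map_mul, curry_pairing, curry_pairing]
  rfl

/-- The identity `r(a, bc) = r(a₁, c) r(a₂, b)` for a fixed element `a`. -/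
def MulRightAt (a : K) : Prop := ∀ b c : L, pairing Q (a ⊗ₜ (b * c)) =
    LinearMap.mul' k k (TensorProduct.map ((TensorProduct.curry (pairing Q)).flip c)
      ((TensorProduct.curry (pairing Q)).flip b) (Coalgebra.comul a))

variable {Q}

theorem MulRightAt.of_algebraMap (z : k) : MulRightAt Q (algebraMap k K z) := by
  intro b c
  simp [Algebra.algebraMap_eq_smul_one, Algebra.TensorProduct.one_def, pairing_tmul,
    LinearMap.convOne_def, mul_comm]

theorem MulRightAt.add {a b : K} (ha : MulRightAt Q a) (hb : MulRightAt Q b) :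
    MulRightAt Q (a + b) := fun c d => by
  simp only [TensorProduct.add_tmul, map_add, ha c d, hb c d]

/-- Expand `r(xy, bc)` in the first variable, then each factor in the second; multiplicativity of
`Δ` on both `bc` and `xy` and commutativity of `k` match the terms. Hence the second
multiplicativity axiom needs checking only for generators in the first variable. -/
theorem MulRightAt.mul {x y : K} (hx : MulRightAt Q x) (hy : MulRightAt Q y) :
    MulRightAt Q (x * y) := by
  intro b c
  have rx := (Coalgebra.Repr.arbitrary k x)
  have ry := (Coalgebra.Repr.arbitrary k y)
  have rb := (Coalgebra.Repr.arbitrary k b)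
  have rc := (Coalgebra.Repr.arbitrary k c)
  rw [pairing_mul_left, Bialgebra.comul_mul, Bialgebra.comul_mul, ← rx.eq, ← ry.eq, ← rb.eq,
    ← rc.eq]
  simp only [Finset.sum_mul_sum, Algebra.TensorProduct.tmul_mul_tmul, map_sum,
    TensorProduct.map_tmul, LinearMap.mul'_apply, TensorProduct.curry_apply,
    LinearMap.flip_apply, hx _ _, hy _ _, pairing_mul_left, ← rx.eq, ← ry.eq, ← rb.eq, ← rc.eq]
  have sw : ∀ (s₁ s₂ : Finset (L × L)) (s₃ s₄ : Finset (K × K))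
      (F : L × L → L × L → K × K → K × K → k),
      ∑ b ∈ s₁, ∑ c ∈ s₂, ∑ x ∈ s₃, ∑ y ∈ s₄, F b c x y =
        ∑ x ∈ s₃, ∑ y ∈ s₄, ∑ c ∈ s₂, ∑ b ∈ s₁, F b c x y := by
    intro s₁ s₂ s₃ s₄ F
    have := Finset.sum_comm (s := s₁ ×ˢ s₂) (t := s₃ ×ˢ s₄)
      (f := fun p q => F p.1 p.2 q.1 q.2)
    simp only [Finset.sum_product] at this
    rw [this]
    exact Finset.sum_congr rfl fun _ _ => Finset.sum_congr rfl fun _ _ => Finset.sum_comm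
  rw [sw]
  exact Finset.sum_congr rfl fun _ _ => Finset.sum_congr rfl fun _ _ =>
    Finset.sum_congr rfl fun _ _ => Finset.sum_congr rfl fun _ _ => by ring

end

section

variable {K : Type u} [Ring K] [Bialgebra k K] (Q : K →ₐ[k] WithConv (K →ₗ[k] k))

/-- The algebra map sending `a` to the map `b ↦ r(a,b) 1`. -/
def scalarConv : K →ₐ[k] WithConv (K →ₗ[k] K) where
  toFun a := WithConv.toConv (Algebra.linearMap k K ∘ₗ (Q a).ofConv)
  map_one' := by rw [map_one]; rfl
  map_mul' a b := by
    have := LinearMap.algHom_comp_convMul_distrib (Algebra.ofId k K) (Q a) (Q b)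
    rw [map_mul]
    exact congrArg WithConv.toConv this
  map_zero' := by ext; simp
  map_add' a b := by ext; simp
  commutes' z := by ext b; simp [Algebra.algebraMap_eq_smul_one, smul_smul]

/-- Either convolution product is `c ↦ r(a, c) b`, because one factor takes scalar values and the
other is `b` times the counit. This is what lets the two maps be combined on `K ⊗ K`. -/
theorem scalarConv_commute (a b : K) :
    Commute (scalarConv Q a) (YBCoeff.constConv k K b) := by
  have : WithConv.toConv (Algebra.linearMap k K ∘ₗ (Q a).ofConv) *
      WithConv.toConv (LinearMap.toSpanSingleton k K b ∘ₗ Coalgebra.counit) =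
      WithConv.toConv (LinearMap.toSpanSingleton k K b ∘ₗ Coalgebra.counit) *
      WithConv.toConv (Algebra.linearMap k K ∘ₗ (Q a).ofConv) := by
    rw [YBCoeff.const_conv, YBCoeff.conv_const]
    ext c
    simp [Algebra.algebraMap_eq_smul_one]
  exact this

/-- The algebra map `a ↦ (b ↦ r(a₁, b) a₂)`. -/
def convLeft : K →ₐ[k] WithConv (K →ₗ[k] K) :=
  (Algebra.TensorProduct.lift (scalarConv Q) (YBCoeff.constConv k K) (scalarConv_commute Q)).comp
    (Bialgebra.comulAlgHom k K)

/-- The algebra map `a ↦ (b ↦ a₁ r(a₂, b))`. -/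
def convRight : K →ₐ[k] WithConv (K →ₗ[k] K) :=
  (Algebra.TensorProduct.lift (YBCoeff.constConv k K) (scalarConv Q)
    (fun x y => (scalarConv_commute Q y x).symm)).comp (Bialgebra.comulAlgHom k K)

/-- Together with `id_mul_convRight`, this recasts the commutation axiom: the identity of `K`, as an
element of the convolution algebra of endomorphisms, intertwines the algebra maps `convRight` and
`convLeft`. An intertwining relation can be tested on generators `a`. -/
theorem convLeft_mul_id (a b : K) : (convLeft Q a * WithConv.toConv LinearMap.id).ofConv b =
    TensorProduct.lid k K (TensorProduct.map (pairing Q) (LinearMap.mul' k K)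
      (Coalgebra.comul (R := k) (a ⊗ₜ[k] b))) := by
  change _ = TensorProduct.lid k K (TensorProduct.map (pairing Q) (LinearMap.mul' k K)
      (TensorProduct.tensorTensorTensorComm k _ _ _ _ (Coalgebra.comul a ⊗ₜ[k] Coalgebra.comul b)))
  change (Algebra.TensorProduct.lift (scalarConv Q) (YBCoeff.constConv k K) (scalarConv_commute Q)
    (Coalgebra.comul a) * _).ofConv b = _
  induction (Coalgebra.comul a : K ⊗[k] K) with
  | zero => simp
  | add x y hx hy => simp only [map_add, add_mul, TensorProduct.add_tmul, hx, hy,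
      WithConv.ofConv_add, LinearMap.add_apply]
  | tmul x y =>
    rw [Algebra.TensorProduct.lift_tmul, mul_assoc]
    have : YBCoeff.constConv k K y * WithConv.toConv LinearMap.id =
      WithConv.toConv (LinearMap.mulLeft k y ∘ₗ LinearMap.id) := YBCoeff.const_conv _ _
    rw [this]
    change LinearMap.mul' k _ (TensorProduct.map (Algebra.linearMap k K ∘ₗ
      (Q x).ofConv) (LinearMap.mulLeft k y ∘ₗ LinearMap.id) (Coalgebra.comul b)) = _
    induction (Coalgebra.comul b : K ⊗[k] K) with
    | zero => simp
    | add x y hx hy => simp only [map_add, TensorProduct.tmul_add, hx, hy]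
    | tmul p q => simp [pairing_tmul, Algebra.algebraMap_eq_smul_one]

theorem id_mul_convRight (a b : K) : (WithConv.toConv LinearMap.id * convRight Q a).ofConv b =
    TensorProduct.rid k K (TensorProduct.map
      (LinearMap.mul' k K ∘ₗ (TensorProduct.comm k K K).toLinearMap) (pairing Q)
      (Coalgebra.comul (R := k) (a ⊗ₜ[k] b))) := by
  change _ = TensorProduct.rid k K (TensorProduct.map
      (LinearMap.mul' k K ∘ₗ (TensorProduct.comm k K K).toLinearMap) (pairing Q)
      (TensorProduct.tensorTensorTensorComm k _ _ _ _ (Coalgebra.comul a ⊗ₜ[k] Coalgebra.comul b)))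
  change (_ * Algebra.TensorProduct.lift (YBCoeff.constConv k K) (scalarConv Q)
    (fun x y => (scalarConv_commute Q y x).symm) (Coalgebra.comul a)).ofConv b = _
  induction (Coalgebra.comul a : K ⊗[k] K) with
  | zero => simp
  | add x y hx hy => simp only [map_add, mul_add, TensorProduct.add_tmul, hx, hy,
      WithConv.ofConv_add, LinearMap.add_apply]
  | tmul x y =>
    rw [Algebra.TensorProduct.lift_tmul, ← mul_assoc]
    have : WithConv.toConv LinearMap.id * YBCoeff.constConv k K x =
      WithConv.toConv (LinearMap.mulRight k x ∘ₗ LinearMap.id) := YBCoeff.conv_const _ _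
    rw [this]
    change LinearMap.mul' k _ (TensorProduct.map (LinearMap.mulRight k x ∘ₗ LinearMap.id)
      (Algebra.linearMap k K ∘ₗ (Q y).ofConv) (Coalgebra.comul b)) = _
    induction (Coalgebra.comul b : K ⊗[k] K) with
    | zero => simp
    | add x y hx hy => simp only [map_add, TensorProduct.tmul_add, hx, hy]
    | tmul p q => simp [pairing_tmul, Algebra.algebraMap_eq_smul_one]

end

end Pairing

/-! ### Extension of the universal form to `A(c)[D⁻¹]` -/

namespace Loc

variable {k : Type u} [Field k] {n : ℕ} {C C' : Fin n → Fin n → Fin n → Fin n → k}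
  {D : GroupLike k (FRT C)} (h : YBCoeff C) (hi : YBCoeff.IsInverse C C') (h' : YBCoeff C')

/-- The inverse of the matrix `h.matHom D`. -/
def invMat (D : GroupLike k (FRT C)) : Matrix (Fin n) (Fin n) k :=
  Matrix.of fun a i => YBCoeff.invFnl hi h' i a D.val

/-- This is `r * r⁻¹ = ε` on the pair `(t_j^i, D)`, where no comultiplication sum over `D` appears
because `D` is group-like. It allows the representation `r(t_i^j, -)` to extend to `D⁻¹`. -/
theorem invMat_mul : invMat hi h' D * h.matHom D.val = 1 := by
  ext i j
  have := h.inv_t hi h' j i D.val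
  simpa [D.isGroupLikeElem_val.comul_eq_tmul_self, D.isGroupLikeElem_val.counit_eq_one,
    Matrix.mul_apply, Matrix.one_apply, invMat, mul_comm, eq_comm] using this

/-- The extension of `h.matHom` to `A(c)[D⁻¹]`. -/
def matHom : Loc D →ₐ[k] Matrix (Fin n) (Fin n) k :=
  lift h.matHom (invMat hi h' D) (mul_eq_one_comm.1 (invMat_mul h hi h')) (invMat_mul h hi h')

@[simp] theorem matHom_ι (a : FRT C) : matHom h hi h' (ι D a) = h.matHom a := by
  simp [matHom]

/-- The functional `r(t_i^j, -)` on `A(c)[D⁻¹]`. -/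
def fnl (D : GroupLike k (FRT C)) (i j : Fin n) : Loc D →ₗ[k] k :=
  Matrix.entryLinearMap k k j i ∘ₗ (matHom h hi h').toLinearMap

@[simp] theorem fnl_apply (i j : Fin n) (a : Loc D) :
    fnl h hi h' D i j a = matHom h hi h' a j i := rfl

theorem fnl_comp_ι (i j : Fin n) : fnl h hi h' D i j ∘ₗ (ι D).toLinearMap = h.fnl i j := by
  ext a; simp

theorem fnl_mul (i j : Fin n) (a b : Loc D) :
    fnl h hi h' D i j (a * b) = ∑ m, fnl h hi h' D m j a * fnl h hi h' D i m b := by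
  simp [Matrix.mul_apply]

/-- The algebra map with `((i, j), (r, s))` entry `a ↦ r(t_r^i, a₁) r(t_s^j, a₂)`. -/
def mat₂ : Loc D →ₐ[k] Matrix (Fin n × Fin n) (Fin n × Fin n) k :=
  (Matrix.kroneckerAlgEquiv (Fin n) (Fin n) k).toAlgHom.comp
    ((Algebra.TensorProduct.map (matHom (D := D) h hi h') (matHom (D := D) h hi h')).comp
      (Bialgebra.comulAlgHom k (Loc D)))

theorem mat₂_apply (a : Loc D) (p q : Fin n × Fin n) : mat₂ h hi h' a p q =
    LinearMap.mul' k k (TensorProduct.map (fnl h hi h' D q.1 p.1) (fnl h hi h' D q.2 p.2)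
      (Coalgebra.comul a)) := by
  change Matrix.kroneckerAlgEquiv (Fin n) (Fin n) k (Algebra.TensorProduct.map (matHom h hi h')
    (matHom h hi h') (Coalgebra.comul a)) p q = _
  induction (Coalgebra.comul a : Loc D ⊗[k] Loc D) with
  | zero => simp
  | add x y hx hy => simp only [map_add, Matrix.add_apply, hx, hy]
  | tmul x y => simp [Matrix.kroneckerAlgEquiv]

theorem mat₂_ι (a : FRT C) : mat₂ h hi h' (ι D a) = (h.mat₂ a).transpose := by
  ext p q
  rw [mat₂_apply, comul_ι, ← LinearMap.comp_apply (TensorProduct.map _ _),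
    ← TensorProduct.map_comp, fnl_comp_ι, fnl_comp_ι]
  rfl

/-- On `A(c)` this is the transpose of `YBCoeff.mat₂_comm`, that is, the braid equation;
`intertwine` carries it over to `D⁻¹`. Entrywise it says that the functionals `r(t_i^j, -)` on
`A(c)[D⁻¹]` satisfy the FRT relations under convolution. -/
theorem mat₂_comm (a : Loc D) :
    (Matrix.of fun p q : Fin n × Fin n => C p.1 p.2 q.1 q.2).transpose * mat₂ h hi h' a =
      mat₂ h hi h' a * (Matrix.of fun p q : Fin n × Fin n => C p.1 p.2 q.1 q.2).transpose := by
  refine intertwine (mat₂ h hi h') (mat₂ h hi h') _ (fun i j => ?_) a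
  rw [mat₂_ι, ← Matrix.transpose_mul, ← Matrix.transpose_mul, h.mat₂_comm]

/-- The algebra map `a ↦ r(a, -)` from `A(c)` to the convolution dual of `A(c)[D⁻¹]`. -/
def convFRT (D : GroupLike k (FRT C)) : FRT C →ₐ[k] WithConv (Loc D →ₗ[k] k) :=
  FRT.lift (fun i j => WithConv.toConv (fnl h hi h' D i j)) (by
    intro i j r s
    ext X
    have := congrFun (congrFun (mat₂_comm h hi h' X) (r, s)) (i, j)
    simpa [Matrix.mul_apply, Fintype.sum_prod_type, mat₂_apply, LinearMap.convMul_def, mul_comm]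
      using this.symm)

@[simp] theorem convFRT_t (i j : Fin n) :
    convFRT h hi h' D (FRT.t C i j) = WithConv.toConv (fnl h hi h' D i j) := FRT.lift_t _ _ i j

theorem mulRightAt_convFRT (a : FRT C) : MulRightAt (convFRT h hi h' D) a := by
  induction a using FRT.induction with
  | h1 z => exact .of_algebraMap z
  | hmul a b ha hb => exact ha.mul hb
  | hadd a b ha hb => exact ha.add hb
  | ht i j =>
    intro b c
    simp [pairing_tmul, fnl_mul, mul_comm, -fnl_apply]

theorem convFRT_one (a : FRT C) : (convFRT h hi h' D a).ofConv 1 = Coalgebra.counit (R := k) a := by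
  induction a using FRT.induction with
  | h1 z => simp [Algebra.algebraMap_eq_smul_one, LinearMap.convOne_def]
  | ht i j => simp [Matrix.one_apply, eq_comm]
  | hadd x y hx hy => simp only [map_add, WithConv.ofConv_add, LinearMap.add_apply, hx, hy]
  | hmul x y hx hy =>
    simp [LinearMap.convMul_def, Algebra.TensorProduct.one_def, hx, hy]

/-- The character `r(D, -)` of `A(c)[D⁻¹]`. -/
def qdetChar (D : GroupLike k (FRT C)) : Loc D →ₐ[k] k :=
  AlgHom.ofLinearMap (convFRT h hi h' D D.val).ofConv
    (by rw [convFRT_one, D.isGroupLikeElem_val.counit_eq_one])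
    (fun b c => by
      have := mulRightAt_convFRT h hi h' D.val b c
      simpa [pairing_tmul, D.isGroupLikeElem_val.comul_eq_tmul_self, mul_comm] using this)

variable {S : Loc D →ₐ[k] (Loc D)ᵐᵒᵖ} (hS : ∀ a, ConvInvAt S (AlgHom.id k (Loc D)) a)

include hS in
-- A character `χ` of a Hopf algebra has convolution inverse `χ ∘ S`: apply `χ` to `id * S = 1`.
-- Thus `r(D⁻¹, -)` has to be `r(D, S(-))`.
theorem qdetChar_mul_inv : convFRT h hi h' D D.val *
    WithConv.toConv ((qdetChar h hi h' D).toLinearMap ∘ₗ antiLin S) = 1 := by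
  have e := LinearMap.algHom_comp_convMul_distrib (qdetChar h hi h' D)
    (WithConv.toConv LinearMap.id) (WithConv.toConv (antiLin S))
  have e' : WithConv.toConv LinearMap.id * WithConv.toConv (antiLin S) = 1 := by
    ext a; exact (hS a).2
  rw [e'] at e
  refine Eq.trans (congrArg WithConv.toConv e.symm) ?_
  ext a
  simp

include hS in
theorem inv_mul_qdetChar : WithConv.toConv ((qdetChar h hi h' D).toLinearMap ∘ₗ antiLin S) *
    convFRT h hi h' D D.val = 1 := by
  have e := LinearMap.algHom_comp_convMul_distrib (qdetChar h hi h' D)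
    (WithConv.toConv (antiLin S)) (WithConv.toConv LinearMap.id)
  have e' : WithConv.toConv (antiLin S) * WithConv.toConv LinearMap.id = 1 := by
    ext a; exact (hS a).1
  rw [e'] at e
  refine Eq.trans (congrArg WithConv.toConv e.symm) ?_
  ext a
  simp

/-- The algebra map `a ↦ r(a, -)` from `A(c)[D⁻¹]` to its convolution dual. -/
def conv : Loc D →ₐ[k] WithConv (Loc D →ₗ[k] k) :=
  lift (convFRT h hi h' D) _ (qdetChar_mul_inv h hi h' hS) (inv_mul_qdetChar h hi h' hS)

@[simp] theorem conv_ι (a : FRT C) : conv h hi h' hS (ι D a) = convFRT h hi h' D a := by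
  simp [conv]

@[simp] theorem conv_inv : conv h hi h' hS (inv D) =
    WithConv.toConv ((qdetChar h hi h' D).toLinearMap ∘ₗ antiLin S) := by
  simp [conv]

theorem mulRightAt_conv (a : Loc D) : MulRightAt (conv h hi h' hS) a := by
  induction a using Loc.induction with
  | h1 z => exact .of_algebraMap z
  | hmul a b ha hb => exact ha.mul hb
  | hadd a b ha hb => exact ha.add hb
  | ht i j =>
    intro b c
    simp [pairing_tmul, fnl_mul, mul_comm, -fnl_apply]
  -- Here `r(D⁻¹, -) = χ ∘ S` reverses products, which is what the axiom asks for with `Δ(D⁻¹) = D⁻¹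
  -- ⊗ D⁻¹`.
  | hinv =>
    intro b c
    simp [pairing_tmul]

end Loc

/-! ### Coquasitriangularity of a pairing on a Hopf algebra -/

section Pairing

variable {k : Type u} [Field k] {K : Type u} [Ring K] [Bialgebra k K]
  {Q : K →ₐ[k] WithConv (K →ₗ[k] k)} {S : K →ₐ[k] Kᵐᵒᵖ}

/-- If `S` is an antipode, then `r(S(a), b)` is the convolution inverse of `r(a, b)`. -/
theorem isConvInverse_pairing (hS : ∀ a, ConvInvAt S (AlgHom.id k K) a) :
    IsConvInverse (pairing Q)
      (pairing Q ∘ₗ TensorProduct.map (antiLin S) LinearMap.id) := by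
  constructor
  · ext a b
    -- As `Q` is an algebra map, `r(a₁, b₁) r(S(a₂), b₂) = r(a₁S(a₂), b)`, and the antipode axiom
    -- finishes the computation.
    have e : ∀ X : K ⊗[k] K, LinearMap.mul' k k (TensorProduct.map (pairing Q)
        (pairing Q ∘ₗ TensorProduct.map (antiLin S) LinearMap.id)
        (TensorProduct.tensorTensorTensorComm k _ _ _ _ (X ⊗ₜ[k] Coalgebra.comul b))) =
        (Q (LinearMap.mul' k K (TensorProduct.map (AlgHom.id k K).toLinearMap
          (antiLin S) X))).ofConv b := by
      intro X
      induction X with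
      | zero => simp
      | add x y hx hy => simp only [map_add, TensorProduct.add_tmul, hx, hy,
          WithConv.ofConv_add, LinearMap.add_apply]
      | tmul x y =>
        simp only [TensorProduct.map_tmul, LinearMap.mul'_apply, map_mul, LinearMap.convMul_def,
          LinearMap.comp_apply]
        induction (Coalgebra.comul b : K ⊗[k] K) with
        | zero => simp
        | add x y hx hy => simp only [map_add, TensorProduct.tmul_add, hx, hy]
        | tmul p q => simp [pairing_tmul]
    refine (e _).trans ?_
    rw [(hS a).2]
    simp [mul_comm, Algebra.algebraMap_eq_smul_one]
  · ext a b
    have e : ∀ X : K ⊗[k] K, LinearMap.mul' k k (TensorProduct.map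
        (pairing Q ∘ₗ TensorProduct.map (antiLin S) LinearMap.id) (pairing Q)
        (TensorProduct.tensorTensorTensorComm k _ _ _ _ (X ⊗ₜ[k] Coalgebra.comul b))) =
        (Q (LinearMap.mul' k K (TensorProduct.map (antiLin S)
          (AlgHom.id k K).toLinearMap X))).ofConv b := by
      intro X
      induction X with
      | zero => simp
      | add x y hx hy => simp only [map_add, TensorProduct.add_tmul, hx, hy,
          WithConv.ofConv_add, LinearMap.add_apply]
      | tmul x y =>
        simp only [TensorProduct.map_tmul, LinearMap.mul'_apply, map_mul, LinearMap.convMul_def,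
          LinearMap.comp_apply]
        induction (Coalgebra.comul b : K ⊗[k] K) with
        | zero => simp
        | add x y hx hy => simp only [map_add, TensorProduct.tmul_add, hx, hy]
        | tmul p q => simp [pairing_tmul]
    refine (e _).trans ?_
    rw [(hS a).1]
    simp [mul_comm, Algebra.algebraMap_eq_smul_one]

theorem isCoquasitriangular_pairing (hS : ∀ a, ConvInvAt S (AlgHom.id k K) a)
    (hmul : ∀ a, MulRightAt Q a)
    (hcomm : ∀ a, WithConv.toConv LinearMap.id * convRight Q a =
      convLeft Q a * WithConv.toConv LinearMap.id) : IsCoquasitriangular (pairing Q) where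
  inv := ⟨_, isConvInverse_pairing hS⟩
  mul_left := pairing_mul_left Q
  mul_right := hmul
  comm a b := by
    rw [← convLeft_mul_id, ← id_mul_convRight, hcomm]

end Pairing

/-! ### The commutation axiom on `A(c)[D⁻¹]` -/

namespace Loc

variable {k : Type u} [Field k] {n : ℕ} {C C' : Fin n → Fin n → Fin n → Fin n → k}
  {D : GroupLike k (FRT C)} (h : YBCoeff C) (hi : YBCoeff.IsInverse C C') (h' : YBCoeff C')

/-- `h.matHom`, with values in the matrices over `A(c)[D⁻¹]`. -/
def matHomLoc : Loc D →ₐ[k] Matrix (Fin n) (Fin n) (Loc D) :=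
  (Algebra.ofId k (Loc D)).mapMatrix.comp (matHom h hi h')

theorem matHomLoc_commute (a b : Loc D) :
    Commute (matHomLoc h hi h' a) (Matrix.scalarAlgHom (Fin n) k b) := by
  change _ * Matrix.scalar (Fin n) b = Matrix.scalar (Fin n) b * _
  ext i j
  simp [matHomLoc, Matrix.scalar_apply, Matrix.mul_diagonal, Matrix.diagonal_mul,
    Algebra.ofId_apply, Algebra.commutes]

/-- The algebra map with `(j, i)` entry `b ↦ r(t_i^j, b₁) b₂`. -/
def matLeft : Loc D →ₐ[k] Matrix (Fin n) (Fin n) (Loc D) :=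
  (Algebra.TensorProduct.lift (matHomLoc (D := D) h hi h') (Matrix.scalarAlgHom (Fin n) k)
    (matHomLoc_commute h hi h')).comp (Bialgebra.comulAlgHom k (Loc D))

/-- The algebra map with `(j, i)` entry `b ↦ b₁ r(t_i^j, b₂)`. -/
def matRight : Loc D →ₐ[k] Matrix (Fin n) (Fin n) (Loc D) :=
  (Algebra.TensorProduct.lift (Matrix.scalarAlgHom (Fin n) k) (matHomLoc (D := D) h hi h')
    (fun x y => (matHomLoc_commute h hi h' y x).symm)).comp (Bialgebra.comulAlgHom k (Loc D))

theorem matLeft_apply (b x : Loc D) (i j : Fin n) : x * matLeft h hi h' b j i =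
    TensorProduct.lid k (Loc D) (TensorProduct.map (fnl h hi h' D i j)
      (LinearMap.mulLeft k x) (Coalgebra.comul b)) := by
  change x * Algebra.TensorProduct.lift (matHomLoc h hi h') (Matrix.scalarAlgHom (Fin n) k)
    (matHomLoc_commute h hi h') (Coalgebra.comul b) j i = _
  induction (Coalgebra.comul b : Loc D ⊗[k] Loc D) with
  | zero => simp
  | add x y hx hy => simp only [map_add, Matrix.add_apply, mul_add, hx, hy]
  | tmul p q =>
    change x * (matHomLoc h hi h' p * Matrix.scalar (Fin n) q) j i = _
    simp [matHomLoc, Matrix.scalar_apply, Matrix.mul_diagonal, Algebra.ofId_apply,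
      Algebra.algebraMap_eq_smul_one]

theorem matRight_apply (b x : Loc D) (i j : Fin n) : matRight h hi h' b j i * x =
    TensorProduct.rid k (Loc D) (TensorProduct.map (LinearMap.mulRight k x)
      (fnl h hi h' D i j) (Coalgebra.comul b)) := by
  change Algebra.TensorProduct.lift (Matrix.scalarAlgHom (Fin n) k) (matHomLoc h hi h')
    (fun x y => (matHomLoc_commute h hi h' y x).symm) (Coalgebra.comul b) j i * x = _
  induction (Coalgebra.comul b : Loc D ⊗[k] Loc D) with
  | zero => simp
  | add x y hx hy => simp only [map_add, Matrix.add_apply, add_mul, hx, hy]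
  | tmul p q =>
    change (Matrix.scalar (Fin n) p * matHomLoc h hi h' q) j i * x = _
    simp [matHomLoc, Matrix.scalar_apply, Matrix.diagonal_mul, Algebra.ofId_apply,
      Algebra.algebraMap_eq_smul_one]

/-- This is the commutation axiom for the pair `(t_i^j, b)`. As a statement about `b`, it says that
the matrix `t` intertwines the algebra maps `matLeft` and `matRight`, so it reduces to `b = t_p^q`,
where it is the FRT relation. -/
theorem conv_comm_t (i j : Fin n) (b : Loc D) :
    ∑ m, TensorProduct.lid k (Loc D) (TensorProduct.map (fnl h hi h' D i m)
        (LinearMap.mulLeft k (ι D (FRT.t C m j))) (Coalgebra.comul b)) =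
      ∑ m, TensorProduct.rid k (Loc D) (TensorProduct.map
        (LinearMap.mulRight k (ι D (FRT.t C i m))) (fnl h hi h' D m j) (Coalgebra.comul b)) := by
  have key := intertwine (matLeft (D := D) h hi h') (matRight h hi h')
    -- The matrix is transposed because `matLeft` and `matRight` carry the functional of `t_i^j` in
    -- their `(j, i)` entry.
    (Matrix.of fun j m => ι D (FRT.t C m j)) (fun p q => by
      ext j i
      have := t_rel (D := D) p i j q
      simp only [Matrix.mul_apply, Matrix.of_apply, matLeft_apply, matRight_apply, comul_ι,
        FRT.comul_t, map_sum, TensorProduct.map_tmul, fnl_apply, AlgHom.toLinearMap_apply,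
        matHom_ι, YBCoeff.matHom_t, LinearMap.mulLeft_apply, LinearMap.mulRight_apply,
        TensorProduct.lid_tmul, TensorProduct.rid_tmul]
      rw [this, Finset.sum_comm]) b
  have := congrFun (congrFun key j) i
  simpa only [Matrix.mul_apply, Matrix.of_apply, matLeft_apply, matRight_apply] using this

variable {S : Loc D →ₐ[k] (Loc D)ᵐᵒᵖ} (hS : ∀ a, ConvInvAt S (AlgHom.id k (Loc D)) a)

/-- `intertwine` is used once more, now in the variable `a` and with the identity map as
intertwiner. Only `a = t_i^j` remains, which is `conv_comm_t`; the element `D⁻¹` never has to be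
treated directly. -/
theorem convRight_eq_convLeft (a : Loc D) :
    WithConv.toConv LinearMap.id * convRight (conv h hi h' hS) a =
      convLeft (conv h hi h' hS) a * WithConv.toConv LinearMap.id := by
  refine intertwine _ _ _ (fun i j => ?_) a
  ext b
  rw [convLeft_mul_id, id_mul_convRight]
  have e₁ : ∀ m Y, TensorProduct.lid k (Loc D) (TensorProduct.map (pairing (conv h hi h' hS))
      (LinearMap.mul' k (Loc D)) (TensorProduct.tensorTensorTensorComm k _ _ _ _
        ((ι D (FRT.t C i m) ⊗ₜ[k] ι D (FRT.t C m j)) ⊗ₜ[k] Y))) =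
      TensorProduct.lid k (Loc D) (TensorProduct.map (fnl h hi h' D i m)
        (LinearMap.mulLeft k (ι D (FRT.t C m j))) Y) := by
    intro m Y
    induction Y with
    | zero => simp
    | add x y hx hy => simp only [map_add, TensorProduct.tmul_add, hx, hy]
    | tmul p q => simp [pairing_tmul]
  have e₂ : ∀ m Y, TensorProduct.rid k (Loc D) (TensorProduct.map
      (LinearMap.mul' k (Loc D) ∘ₗ (TensorProduct.comm k (Loc D) (Loc D)).toLinearMap)
        (pairing (conv h hi h' hS)) (TensorProduct.tensorTensorTensorComm k _ _ _ _
        ((ι D (FRT.t C i m) ⊗ₜ[k] ι D (FRT.t C m j)) ⊗ₜ[k] Y))) =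
      TensorProduct.rid k (Loc D) (TensorProduct.map
        (LinearMap.mulRight k (ι D (FRT.t C i m))) (fnl h hi h' D m j) Y) := by
    intro m Y
    induction Y with
    | zero => simp
    | add x y hx hy => simp only [map_add, TensorProduct.tmul_add, hx, hy]
    | tmul p q => simp [pairing_tmul]
  have := (conv_comm_t h hi h' i j b).symm
  have e : Coalgebra.comul (R := k) (ι D (FRT.t C i j) ⊗ₜ[k] b) =
      TensorProduct.tensorTensorTensorComm k _ _ _ _
        (Coalgebra.comul (ι D (FRT.t C i j)) ⊗ₜ[k] Coalgebra.comul b) := rfl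
  rw [e, comul_ι, FRT.comul_t]
  simpa only [map_sum, TensorProduct.map_tmul, AlgHom.toLinearMap_apply,
    TensorProduct.sum_tmul, e₁, e₂] using this

/-- `A(c)[D⁻¹]` is coquasitriangular if it has an antipode. -/
theorem isCoquasitriangular_conv : IsCoquasitriangular (pairing (conv h hi h' hS)) :=
  isCoquasitriangular_pairing hS (mulRightAt_conv h hi h' hS)
    (convRight_eq_convLeft h hi h' hS)

theorem pairing_conv_t (i j a b : Fin n) :
    pairing (conv h hi h' hS) (ι D (FRT.t C i a) ⊗ₜ ι D (FRT.t C j b)) = C j i a b := by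
  simp [pairing_tmul]

end Loc

/-! ### Unitality, pullback and uniqueness of coquasitriangular forms -/

section Forms

variable {k : Type u} [Field k]

section Pullback

variable {K : Type v} [Ring K] [Bialgebra k K] {L : Type w} [Ring L] [Bialgebra k L]

/-- Unitality is not among the axioms. The functional `r(1, -)` is idempotent under convolution,
since `1 · 1 = 1`, and has the right inverse `r⁻¹(1, -)`; an idempotent with a right inverse is the
unit. -/
theorem IsCoquasitriangular.one_left {R : L ⊗[k] L →ₗ[k] k} (hR : IsCoquasitriangular R) (b : L) :
    R (1 ⊗ₜ b) = Coalgebra.counit (R := k) b := by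
  obtain ⟨R', h, -⟩ := hR.inv
  have h₁ : WithConv.toConv (TensorProduct.curry R 1) * WithConv.toConv (TensorProduct.curry R 1) =
      WithConv.toConv (TensorProduct.curry R 1) := by
    ext b
    have := hR.mul_left 1 1 b
    rw [mul_one] at this
    exact this.symm
  have h₂ : WithConv.toConv (TensorProduct.curry R 1) *
      WithConv.toConv (TensorProduct.curry R' 1) = 1 := by
    ext b
    have := LinearMap.congr_fun h (1 ⊗ₜ b)
    have e : ∀ Y : L ⊗[k] L, LinearMap.mul' k k (TensorProduct.map R R'
        (TensorProduct.tensorTensorTensorComm k _ _ _ _ (((1 : L) ⊗ₜ[k] (1 : L)) ⊗ₜ[k] Y))) =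
        LinearMap.mul' k k (TensorProduct.map (TensorProduct.curry R 1)
          (TensorProduct.curry R' 1) Y) := by
      intro Y
      induction Y with
      | zero => simp
      | add x y hx hy => simp only [map_add, TensorProduct.tmul_add, hx, hy]
      | tmul p q => simp
    refine (e _).symm.trans (Eq.trans ?_ (this.trans ?_))
    · change _ = LinearMap.mul' k k (TensorProduct.map R R'
        (TensorProduct.tensorTensorTensorComm k _ _ _ _
          (Coalgebra.comul (1 : L) ⊗ₜ[k] Coalgebra.comul b)))
      rw [Bialgebra.comul_one, Algebra.TensorProduct.one_def]
    · simp
  have h₃ : WithConv.toConv (TensorProduct.curry R 1) = 1 := by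
    rw [← mul_one (WithConv.toConv _), ← h₂, ← mul_assoc, h₁]
  simpa using congrArg (fun f => f.ofConv b) h₃

theorem IsCoquasitriangular.one_right {R : L ⊗[k] L →ₗ[k] k} (hR : IsCoquasitriangular R) (a : L) :
    R (a ⊗ₜ 1) = Coalgebra.counit (R := k) a := by
  obtain ⟨R', h, -⟩ := hR.inv
  let φ := (TensorProduct.curry R).flip 1
  have h₁ : WithConv.toConv φ * WithConv.toConv φ = WithConv.toConv φ := by
    ext b
    have := hR.mul_right b 1 1
    rw [mul_one] at this
    exact this.symm
  have h₂ : WithConv.toConv φ * WithConv.toConv ((TensorProduct.curry R').flip 1) = 1 := by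
    ext b
    have := LinearMap.congr_fun h (b ⊗ₜ 1)
    have e : ∀ Y : L ⊗[k] L, LinearMap.mul' k k (TensorProduct.map R R'
        (TensorProduct.tensorTensorTensorComm k _ _ _ _ (Y ⊗ₜ[k] ((1 : L) ⊗ₜ[k] (1 : L))))) =
        LinearMap.mul' k k (TensorProduct.map φ ((TensorProduct.curry R').flip 1) Y) := by
      intro Y
      induction Y with
      | zero => simp
      | add x y hx hy => simp only [map_add, TensorProduct.add_tmul, hx, hy]
      | tmul p q => simp [φ]
    refine (e _).symm.trans (Eq.trans ?_ (this.trans ?_))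
    · change _ = LinearMap.mul' k k (TensorProduct.map R R'
        (TensorProduct.tensorTensorTensorComm k _ _ _ _
          (Coalgebra.comul b ⊗ₜ[k] Coalgebra.comul (1 : L))))
      rw [Bialgebra.comul_one, Algebra.TensorProduct.one_def]
    · simp
  have h₃ : WithConv.toConv φ = 1 := by
    rw [← mul_one (WithConv.toConv _), ← h₂, ← mul_assoc, h₁]
  simpa [φ] using congrArg (fun f => f.ofConv a) h₃

/-- The form `r(f(a), f(b))`. -/
def pullbackForm (R : L ⊗[k] L →ₗ[k] k) (f : K →ₐc[k] L) : K ⊗[k] K →ₗ[k] k :=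
  R ∘ₗ TensorProduct.map (f : K →ₗ[k] L) (f : K →ₗ[k] L)

@[simp] theorem pullbackForm_tmul (R : L ⊗[k] L →ₗ[k] k) (f : K →ₐc[k] L) (a b : K) :
    pullbackForm R f (a ⊗ₜ b) = R (f a ⊗ₜ f b) := rfl

theorem BialgHom.comul_apply (f : K →ₐc[k] L) (a : K) : Coalgebra.comul (R := k) (f a) =
    TensorProduct.map (f : K →ₗ[k] L) (f : K →ₗ[k] L) (Coalgebra.comul a) :=
  (CoalgHomClass.map_comp_comul_apply f a).symm

theorem pullbackForm_mul_left {R : L ⊗[k] L →ₗ[k] k} (hR : IsCoquasitriangular R)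
    (f : K →ₐc[k] L) (a b c : K) : pullbackForm R f ((a * b) ⊗ₜ c) =
      LinearMap.mul' k k (TensorProduct.map (TensorProduct.curry (pullbackForm R f) a)
        (TensorProduct.curry (pullbackForm R f) b) (Coalgebra.comul c)) := by
  rw [pullbackForm_tmul, map_mul, hR.mul_left, BialgHom.comul_apply]
  induction (Coalgebra.comul c : K ⊗[k] K) with
  | zero => simp
  | add x y hx hy => simp only [map_add, hx, hy]
  | tmul p q => simp

theorem pullbackForm_mul_right {R : L ⊗[k] L →ₗ[k] k} (hR : IsCoquasitriangular R)
    (f : K →ₐc[k] L) (a b c : K) : pullbackForm R f (a ⊗ₜ (b * c)) =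
      LinearMap.mul' k k (TensorProduct.map ((TensorProduct.curry (pullbackForm R f)).flip c)
        ((TensorProduct.curry (pullbackForm R f)).flip b) (Coalgebra.comul a)) := by
  rw [pullbackForm_tmul, map_mul, hR.mul_right, BialgHom.comul_apply]
  induction (Coalgebra.comul a : K ⊗[k] K) with
  | zero => simp
  | add x y hx hy => simp only [map_add, hx, hy]
  | tmul p q => simp

theorem pullbackForm_convInverse {R R' : L ⊗[k] L →ₗ[k] k} (f : K →ₐc[k] L)
    (h : LinearMap.mul' k k ∘ₗ TensorProduct.map R R' ∘ₗ Coalgebra.comul = Coalgebra.counit) :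
    LinearMap.mul' k k ∘ₗ TensorProduct.map (pullbackForm R f) (pullbackForm R' f) ∘ₗ
      Coalgebra.comul = Coalgebra.counit := by
  ext a b
  have e : ∀ X Y : K ⊗[k] K, LinearMap.mul' k k
      (TensorProduct.map (pullbackForm R f) (pullbackForm R' f)
        (TensorProduct.tensorTensorTensorComm k _ _ _ _ (X ⊗ₜ[k] Y))) =
      LinearMap.mul' k k (TensorProduct.map R R' (TensorProduct.tensorTensorTensorComm k _ _ _ _
        (TensorProduct.map (f : K →ₗ[k] L) (f : K →ₗ[k] L) X ⊗ₜ[k]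
          TensorProduct.map (f : K →ₗ[k] L) (f : K →ₗ[k] L) Y))) := by
    intro X Y
    induction X with
    | zero => simp
    | add x y hx hy => simp only [map_add, TensorProduct.add_tmul, hx, hy]
    | tmul x y =>
      induction Y with
      | zero => simp
      | add x y hx hy => simp only [map_add, TensorProduct.tmul_add, hx, hy]
      | tmul p q => simp
  have := LinearMap.congr_fun h (f a ⊗ₜ f b)
  refine (e _ _).trans (Eq.trans ?_ (this.trans ?_))
  · rw [← BialgHom.comul_apply, ← BialgHom.comul_apply]
    rfl
  · simp

/-- Injectivity serves only the commutation axiom, which is an identity in `K` and is checked after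
applying `f`. The other axioms compare scalars and pull back along any bialgebra map. -/
theorem IsCoquasitriangular.pullback {R : L ⊗[k] L →ₗ[k] k} (hR : IsCoquasitriangular R)
    (f : K →ₐc[k] L) (hf : Function.Injective f) : IsCoquasitriangular (pullbackForm R f) where
  inv := by
    obtain ⟨R', h, h'⟩ := hR.inv
    exact ⟨pullbackForm R' f, pullbackForm_convInverse f h, pullbackForm_convInverse f h'⟩
  mul_left := pullbackForm_mul_left hR f
  mul_right := pullbackForm_mul_right hR f
  comm a b := by
    apply hf
    have e₁ : ∀ X Y : K ⊗[k] K, f (TensorProduct.lid k K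
        (TensorProduct.map (pullbackForm R f) (LinearMap.mul' k K)
          (TensorProduct.tensorTensorTensorComm k _ _ _ _ (X ⊗ₜ[k] Y)))) =
        TensorProduct.lid k L (TensorProduct.map R (LinearMap.mul' k L)
          (TensorProduct.tensorTensorTensorComm k _ _ _ _
          (TensorProduct.map (f : K →ₗ[k] L) (f : K →ₗ[k] L) X ⊗ₜ[k]
            TensorProduct.map (f : K →ₗ[k] L) (f : K →ₗ[k] L) Y))) := by
      intro X Y
      induction X with
      | zero => simp
      | add x y hx hy => simp only [map_add, TensorProduct.add_tmul, hx, hy]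
      | tmul x y =>
        induction Y with
        | zero => simp
        | add x y hx hy => simp only [map_add, TensorProduct.tmul_add, hx, hy]
        | tmul p q => simp
    have e₂ : ∀ X Y : K ⊗[k] K, f (TensorProduct.rid k K (TensorProduct.map
          (LinearMap.mul' k K ∘ₗ (TensorProduct.comm k K K).toLinearMap) (pullbackForm R f)
          (TensorProduct.tensorTensorTensorComm k _ _ _ _ (X ⊗ₜ[k] Y)))) =
        TensorProduct.rid k L (TensorProduct.map
          (LinearMap.mul' k L ∘ₗ (TensorProduct.comm k L L).toLinearMap) R
          (TensorProduct.tensorTensorTensorComm k _ _ _ _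
          (TensorProduct.map (f : K →ₗ[k] L) (f : K →ₗ[k] L) X ⊗ₜ[k]
            TensorProduct.map (f : K →ₗ[k] L) (f : K →ₗ[k] L) Y))) := by
      intro X Y
      induction X with
      | zero => simp
      | add x y hx hy => simp only [map_add, TensorProduct.add_tmul, hx, hy]
      | tmul x y =>
        induction Y with
        | zero => simp
        | add x y hx hy => simp only [map_add, TensorProduct.tmul_add, hx, hy]
        | tmul p q => simp
    have := hR.comm (f a) (f b)
    refine (e₁ _ _).trans (Eq.trans ?_ (this.trans (Eq.trans ?_ (e₂ _ _).symm)))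
    · rw [← BialgHom.comul_apply, ← BialgHom.comul_apply]
      rfl
    · rw [← BialgHom.comul_apply, ← BialgHom.comul_apply]
      rfl

theorem IsAntipode.conj {S : L →ₗ[k] L} (hS : IsAntipode S) (e : K ≃ₐc[k] L) :
    IsAntipode ((e.symm : L →ₗ[k] K) ∘ₗ S ∘ₗ (e : K →ₗ[k] L)) := by
  have comul_e : ∀ a : K, Coalgebra.comul (R := k) (e a) =
      TensorProduct.map (e : K →ₗ[k] L) (e : K →ₗ[k] L) (Coalgebra.comul a) :=
    fun a => (CoalgHomClass.map_comp_comul_apply e a).symm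
  have hinj : Function.Injective (fun a => e a) := EquivLike.injective e
  constructor
  · refine LinearMap.ext fun a => hinj ?_
    have := LinearMap.congr_fun hS.1 (e a)
    simp only [LinearMap.comp_apply, comul_e] at this ⊢
    refine Eq.trans ?_ (this.trans ?_)
    · induction (Coalgebra.comul a : K ⊗[k] K) with
      | zero => simp
      | add x y hx hy => simp only [map_add, hx, hy]
      | tmul p q => simp [map_mul e]
    · simp [Algebra.algebraMap_eq_smul_one, map_one e]
  · refine LinearMap.ext fun a => hinj ?_
    have := LinearMap.congr_fun hS.2 (e a)
    simp only [LinearMap.comp_apply, comul_e] at this ⊢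
    refine Eq.trans ?_ (this.trans ?_)
    · induction (Coalgebra.comul a : K ⊗[k] K) with
      | zero => simp
      | add x y hx hy => simp only [map_add, hx, hy]
      | tmul p q => simp [map_mul e]
    · simp [Algebra.algebraMap_eq_smul_one, map_one e]

end Pullback

section Uniqueness

variable {n : ℕ} {C : Fin n → Fin n → Fin n → Fin n → k}

/-- A bialgebra pairing of `𝓗(c)` with itself is determined by its values on the `t_i^j`. -/
theorem Schauenburg.form_ext {R R' : Schauenburg C ⊗[k] Schauenburg C →ₗ[k] k}
    (one_left : ∀ b, R (1 ⊗ₜ b) = Coalgebra.counit (R := k) b)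
    (one_left' : ∀ b, R' (1 ⊗ₜ b) = Coalgebra.counit (R := k) b)
    (one_right : ∀ b, R (b ⊗ₜ 1) = Coalgebra.counit (R := k) b)
    (one_right' : ∀ b, R' (b ⊗ₜ 1) = Coalgebra.counit (R := k) b)
    (mul_left : ∀ a b c, R ((a * b) ⊗ₜ c) = LinearMap.mul' k k (TensorProduct.map
      (TensorProduct.curry R a) (TensorProduct.curry R b) (Coalgebra.comul c)))
    (mul_left' : ∀ a b c, R' ((a * b) ⊗ₜ c) = LinearMap.mul' k k (TensorProduct.map
      (TensorProduct.curry R' a) (TensorProduct.curry R' b) (Coalgebra.comul c)))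
    (mul_right : ∀ a b c, R (a ⊗ₜ (b * c)) = LinearMap.mul' k k (TensorProduct.map
      ((TensorProduct.curry R).flip c) ((TensorProduct.curry R).flip b) (Coalgebra.comul a)))
    (mul_right' : ∀ a b c, R' (a ⊗ₜ (b * c)) = LinearMap.mul' k k (TensorProduct.map
      ((TensorProduct.curry R').flip c) ((TensorProduct.curry R').flip b) (Coalgebra.comul a)))
    (h : ∀ i a j b, R (t C i a ⊗ₜ t C j b) = R' (t C i a ⊗ₜ t C j b)) : R = R' := by
  let matOf (R : Schauenburg C ⊗[k] Schauenburg C →ₗ[k] k)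
      (one_right : ∀ b, R (b ⊗ₜ 1) = Coalgebra.counit (R := k) b)
      (mul_right : ∀ a b c, R (a ⊗ₜ (b * c)) = LinearMap.mul' k k (TensorProduct.map
        ((TensorProduct.curry R).flip c) ((TensorProduct.curry R).flip b) (Coalgebra.comul a))) :
      Schauenburg C →ₐ[k] Matrix (Fin n) (Fin n) k :=
    AlgHom.ofLinearMap
      { toFun := fun b => Matrix.of fun j i => R (t C i j ⊗ₜ b)
        map_add' := fun b b' => by ext; simp [TensorProduct.tmul_add]
        map_smul' := fun z b => by ext; simp }
      (by ext i j; simp [one_right, Matrix.one_apply, eq_comm])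
      (fun b c => by ext i j; simp [mul_right, Matrix.mul_apply, mul_comm])
  let convOf (R : Schauenburg C ⊗[k] Schauenburg C →ₗ[k] k)
      (one_left : ∀ b, R (1 ⊗ₜ b) = Coalgebra.counit (R := k) b)
      (mul_left : ∀ a b c, R ((a * b) ⊗ₜ c) = LinearMap.mul' k k (TensorProduct.map
        (TensorProduct.curry R a) (TensorProduct.curry R b) (Coalgebra.comul c))) :
      Schauenburg C →ₐ[k] WithConv (Schauenburg C →ₗ[k] k) :=
    AlgHom.ofLinearMap
      ((WithConv.linearEquiv k _).symm.toLinearMap ∘ₗ TensorProduct.curry R)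
      (by ext b; simp [one_left])
      (fun a b => by ext c; exact mul_left a b c)
  -- The matrix `(R(t_i^j ⊗ b))` is an algebra map in `b`, and `R(a ⊗ -)` is one in `a` with values
  -- in the convolution dual. Each is determined by the `t_i^j`, so no value on a `u_i^j` has to be
  -- compared.
  have e₁ : matOf R one_right mul_right = matOf R' one_right' mul_right' :=
    algHom_ext_t fun i j => by ext p q; exact h _ _ _ _
  have e₂ : convOf R one_left mul_left = convOf R' one_left' mul_left' :=
    algHom_ext_t fun i j => by
      ext b
      exact congrFun (congrFun (DFunLike.congr_fun e₁ b) j) i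
  refine TensorProduct.ext' fun a b => ?_
  exact congrArg (fun f => f.ofConv b) (DFunLike.congr_fun e₂ a)

end Uniqueness

end Forms

/-! ### Matrix coefficients of a coaction -/

section Coactions

variable {k : Type u} [Field k] {V : Type v} [AddCommGroup V] [Module k V] {n : ℕ}
  (x : Module.Basis (Fin n) k V) {K : Type w} [Ring K] [Bialgebra k K]

/-- The `j`-th coordinate of an element of `M ⊗ V`. -/
def tensorCoord {M : Type z} [AddCommGroup M] [Module k M] (j : Fin n) : M ⊗[k] V →ₗ[k] M :=
  (TensorProduct.rid k M).toLinearMap ∘ₗ TensorProduct.map LinearMap.id (x.coord j)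

@[simp] theorem tensorCoord_tmul {M : Type z} [AddCommGroup M] [Module k M] (j : Fin n) (m : M)
    (v : V) : tensorCoord x j (m ⊗ₜ[k] v) = x.coord j v • m := by simp [tensorCoord]

theorem sum_tensorCoord {M : Type z} [AddCommGroup M] [Module k M] (y : M ⊗[k] V) :
    ∑ j, tensorCoord x j y ⊗ₜ[k] x j = y := by
  induction y with
  | zero => simp
  | add y y' h h' => simp only [map_add, TensorProduct.add_tmul, Finset.sum_add_distrib, h, h']
  | tmul m v =>
    simp only [tensorCoord_tmul, TensorProduct.smul_tmul, ← TensorProduct.tmul_sum,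
      Module.Basis.coord_apply, x.sum_repr]

theorem tensorCoord_sum {M : Type z} [AddCommGroup M] [Module k M] (m : Fin n → M) (j : Fin n) :
    tensorCoord x j (∑ i, m i ⊗ₜ[k] x i) = m j := by
  simp [Finsupp.single_apply]

variable {x} {ρ : V →ₗ[k] K ⊗[k] V} {f : Fin n → Fin n → K}

theorem IsLeftCoaction.comul_coeff (hρ : IsLeftCoaction ρ)
    (hf : ∀ i, ρ (x i) = ∑ j, f i j ⊗ₜ[k] x j) (i j : Fin n) :
    Coalgebra.comul (R := k) (f i j) = ∑ a, f i a ⊗ₜ[k] f a j := by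
  have h := congrArg (fun y => tensorCoord x j ((TensorProduct.assoc k K K V).symm y))
    (hρ.coassoc (x i))
  simp only [LinearEquiv.symm_apply_apply, hf, map_sum, TensorProduct.map_tmul,
    TensorProduct.tmul_sum, TensorProduct.assoc_symm_tmul, LinearMap.id_apply,
    tensorCoord_tmul, Module.Basis.coord_apply, Module.Basis.repr_self,
    Finsupp.single_apply, ite_smul, one_smul, zero_smul, Finset.sum_ite_eq', Finset.mem_univ,
    if_true] at h
  exact h

theorem IsLeftCoaction.counit_coeff (hρ : IsLeftCoaction ρ)
    (hf : ∀ i, ρ (x i) = ∑ j, f i j ⊗ₜ[k] x j) (i j : Fin n) :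
    Coalgebra.counit (R := k) (f i j) = if i = j then 1 else 0 := by
  have h := congrArg (x.coord j) (hρ.counit (x i))
  simpa [hf, Finsupp.single_apply] using h

theorem isLeftCoaction_of_coeff (hf : ∀ i, ρ (x i) = ∑ j, f i j ⊗ₜ[k] x j)
    (hΔ : ∀ i j, Coalgebra.comul (R := k) (f i j) = ∑ a, f i a ⊗ₜ[k] f a j)
    (hε : ∀ i j, Coalgebra.counit (R := k) (f i j) = if i = j then 1 else 0) :
    IsLeftCoaction ρ where
  coassoc m := by
    have : (TensorProduct.assoc k K K V).toLinearMap ∘ₗ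
        TensorProduct.map Coalgebra.comul LinearMap.id ∘ₗ ρ =
        TensorProduct.map LinearMap.id ρ ∘ₗ ρ := x.ext fun i => by
      simp only [LinearMap.comp_apply, hf, map_sum, TensorProduct.map_tmul, hΔ,
        TensorProduct.sum_tmul, TensorProduct.tmul_sum, LinearEquiv.coe_coe,
        TensorProduct.assoc_tmul, LinearMap.id_apply]
      exact Finset.sum_comm
    exact LinearMap.congr_fun this m
  counit m := by
    have : (TensorProduct.lid k V).toLinearMap ∘ₗ
        TensorProduct.map Coalgebra.counit LinearMap.id ∘ₗ ρ = LinearMap.id := x.ext fun i => by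
      simp [hf, hε]
    exact LinearMap.congr_fun this m

theorem inducedBraiding_apply (R : K ⊗[k] K →ₗ[k] k) (hf : ∀ i, ρ (x i) = ∑ j, f i j ⊗ₜ[k] x j)
    (i j : Fin n) : inducedBraiding R ρ (x i ⊗ₜ x j) =
      ∑ a, ∑ b, R (f j a ⊗ₜ f i b) • (x a ⊗ₜ[k] x b) := by
  simp only [inducedBraiding, LinearMap.comp_apply, LinearEquiv.coe_coe, TensorProduct.comm_tmul,
    TensorProduct.map_tmul, hf, TensorProduct.sum_tmul, TensorProduct.tmul_sum, map_sum,
    TensorProduct.tensorTensorTensorComm_tmul, LinearMap.id_apply, TensorProduct.lid_tmul]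
  exact Finset.sum_comm

theorem form_coeff {R : K ⊗[k] K →ₗ[k] k} {c : V ⊗[k] V ≃ₗ[k] V ⊗[k] V}
    (h : inducedBraiding R ρ = c.toLinearMap) (hf : ∀ i, ρ (x i) = ∑ j, f i j ⊗ₜ[k] x j)
    (i j a b : Fin n) : R (f j a ⊗ₜ f i b) = coeff x c i j a b := by
  have h' := congrArg (fun y => (x.tensorProduct x).repr y (a, b))
    (LinearMap.congr_fun h (x i ⊗ₜ x j))
  simp only [inducedBraiding_apply R hf] at h'
  change _ = coeff x c i j a b at h'
  rw [← h']
  simp [Finsupp.single_apply, Finsupp.finsetSum_apply]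

/-- The FRT relation is the commutation axiom for the pair `(f j r, f i s)`, with the values of the
form read off from `c`. The index `j` comes first because the induced braiding evaluates the form on
the coefficients of the second tensor factor, then the first. -/
theorem coeff_rel {R : K ⊗[k] K →ₗ[k] k} {c : V ⊗[k] V ≃ₗ[k] V ⊗[k] V}
    (hR : IsCoquasitriangular R) (hρ : IsLeftCoaction ρ)
    (h : inducedBraiding R ρ = c.toLinearMap) (hf : ∀ i, ρ (x i) = ∑ j, f i j ⊗ₜ[k] x j)
    (i j r s : Fin n) : ∑ a, ∑ b, coeff x c i j a b • (f a r * f b s) =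
      ∑ a, ∑ b, coeff x c a b r s • (f i a * f j b) := by
  have := hR.comm (f j r) (f i s)
  have e : Coalgebra.comul (R := k) (f j r ⊗ₜ[k] f i s) =
      TensorProduct.tensorTensorTensorComm k _ _ _ _
        (Coalgebra.comul (f j r) ⊗ₜ[k] Coalgebra.comul (f i s)) := rfl
  rw [e, hρ.comul_coeff hf, hρ.comul_coeff hf] at this
  simp only [TensorProduct.sum_tmul, TensorProduct.tmul_sum, map_sum,
    TensorProduct.tensorTensorTensorComm_tmul, TensorProduct.map_tmul, LinearMap.mul'_apply,
    TensorProduct.lid_tmul, TensorProduct.rid_tmul, LinearMap.comp_apply, LinearEquiv.coe_coe,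
    TensorProduct.comm_tmul, form_coeff h hf] at this
  rw [Finset.sum_comm, this]

end Coactions

/-! ### The universal property of `𝓗(c)` -/

section Universal

variable {k : Type u} [Field k] {V : Type v} [AddCommGroup V] [Module k V] {n : ℕ}
  {x : Module.Basis (Fin n) k V} {c : V ⊗[k] V ≃ₗ[k] V ⊗[k] V}

theorem Schauenburg.coaction_apply (C : Fin n → Fin n → Fin n → Fin n → k) (i : Fin n) :
    coaction x C (x i) = ∑ j, t C i j ⊗ₜ[k] x j := by
  simp [coaction]

/-- A coquasitriangular Hopf algebra structure on `𝓗(c)` with `r(t_i^k, t_j^l) = c_{ji}^{kl}` is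
universal. -/
theorem Schauenburg.isUniversalCQTHopf
    {S : Schauenburg (coeff x c) →ₗ[k] Schauenburg (coeff x c)} (hS : IsAntipode S)
    {R : Schauenburg (coeff x c) ⊗[k] Schauenburg (coeff x c) →ₗ[k] k}
    (hR : IsCoquasitriangular R)
    (hRt : ∀ i j a b, R (t (coeff x c) i a ⊗ₜ t (coeff x c) j b) = coeff x c j i a b) :
    IsUniversalCQTHopf.{u, v, u, z} c.toLinearMap R (coaction x (coeff x c)) where
  hopf := ⟨S, hS⟩
  cqt := hR
  coaction := isLeftCoaction_of_coeff (coaction_apply _) comul_t counit_t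
  braiding := (x.tensorProduct x).ext fun p => by
    rw [Module.Basis.tensorProduct_apply, inducedBraiding_apply R (coaction_apply _)]
    simp only [hRt]
    exact (braiding_apply x c _ _).symm
  universal := by
    intro L _ _ R' ρ' hR' hρ' hbr
    let f : Fin n → Fin n → L := fun i j => tensorCoord x j (ρ' (x i))
    have hf : ∀ i, ρ' (x i) = ∑ j, f i j ⊗ₜ[k] x j := fun i => (sum_tensorCoord x _).symm
    have hΔ := hρ'.comul_coeff hf
    have hε := hρ'.counit_coeff hf
    -- The coefficient matrix `f` is comultiplicative, so applying the antipode of `L` entrywise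
    -- gives its inverse; this is the only possible image of `u`.
    let F : Schauenburg (coeff x c) →ₐ[k] L :=
      Schauenburg.lift f (fun i j => HopfAlgebra.antipode k (f i j))
        (coeff_rel hR' hρ' hbr hf)
        (fun i j => by
          have := HopfAlgebra.mul_antipode_rTensor_comul_apply (R := k) (f i j)
          simpa [hΔ, hε, apply_ite (algebraMap k L)] using this)
        (fun i j => by
          have := HopfAlgebra.mul_antipode_lTensor_comul_apply (R := k) (f i j)
          simpa [hΔ, hε, apply_ite (algebraMap k L)] using this)
    have hFt : ∀ i j, F (t _ i j) = f i j := fun i j => Schauenburg.lift_t _ _ _ _ _ i j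
    let G : Schauenburg (coeff x c) →ₐc[k] L := BialgHom.ofAlgHom F
      (algHom_ext_t fun i j => by simp [hFt, hε])
      (algHom_ext_t fun i j => by simp [hFt, hΔ])
    have hGt : ∀ i j, G (t _ i j) = f i j := hFt
    refine ⟨G, x.ext fun i => ?_, ?_, fun g hg => ?_⟩
    · simp [coaction_apply, hf, hGt]
    · have h1 : G 1 = 1 := map_one G
      -- The pullback of `R'` and the form `R` are both bialgebra pairings, and on the `t_i^j` both
      -- are given by the coefficients of `c`.
      refine form_ext (R := pullbackForm R' G) (fun b => ?_) hR.one_left (fun b => ?_)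
        hR.one_right (pullbackForm_mul_left hR' G) hR.mul_left (pullbackForm_mul_right hR' G)
        hR.mul_right (fun i a j b => ?_)
      · rw [pullbackForm_tmul, h1, hR'.one_left]
        exact CoalgHomClass.counit_comp_apply G b
      · rw [pullbackForm_tmul, h1, hR'.one_right]
        exact CoalgHomClass.counit_comp_apply G b
      · rw [pullbackForm_tmul, hGt, hGt, hRt, form_coeff hbr hf]
    -- Compatibility with the coactions, read in the coordinate `x j`, prescribes `g` on the
    -- generators `t_i^j`.
    · have hgt : ∀ i j, g (t _ i j) = f i j := fun i j => by
        have := congrArg (tensorCoord x j) (LinearMap.congr_fun hg (x i))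
        rw [LinearMap.comp_apply, coaction_apply, map_sum] at this
        simp only [TensorProduct.map_tmul, LinearMap.id_apply] at this
        rw [tensorCoord_sum] at this
        exact this.symm
      have : (g : Schauenburg (coeff x c) →ₐ[k] L) = G :=
        algHom_ext_t fun i j => (hgt i j).trans (hGt i j).symm
      exact BialgHom.ext fun a => DFunLike.congr_fun this a

end Universal

/-! ### Laplace expansion and the main theorem -/

namespace WGF

variable {k : Type u} [Field k] {V : Type v} [AddCommGroup V] [Module k V] {n : ℕ}
  {x : Module.Basis (Fin n) k V} {C : Fin n → Fin n → Fin n → Fin n → k}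
  {B : Type w} [Ring B] [Algebra k B] (W : WGF (FRT.coaction x C) B)

/-- The Laplace expansion of the quantum determinant. -/
theorem sum_t_mul_cofactor {b : B} (hb : b ∈ W.gr W.top) (hb0 : b ≠ 0) {ω : Fin n → B}
    (hdual : ∀ i j, W.incl (x i) * ω j = if i = j then b else 0) {T : Fin n → Fin n → FRT C}
    (hT : ∀ i, W.coact (ω i) = ∑ j, T j i ⊗ₜ[k] ω j) (i j : Fin n) :
    ∑ a, FRT.t C i a * T a j = if i = j then W.qdet.val else 0 := by
  -- The coaction of `xᵢ ωʲ` is computed twice: here as a product of coactions, in `h₂` as the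
  -- coaction of a multiple of `b`. A functional with value `1` at `b` then cancels `b`.
  have h₁ : W.coact (W.incl (x i) * ω j) = (∑ a, FRT.t C i a * T a j) ⊗ₜ[k] b := by
    rw [map_mul, W.coact_incl, hT]
    simp [FRT.coaction, Finset.sum_mul_sum, hdual, TensorProduct.sum_tmul, TensorProduct.tmul_ite]
  have h₂ : W.coact (W.incl (x i) * ω j) = (if i = j then W.qdet.val else 0) ⊗ₜ[k] b := by
    rw [hdual]
    split_ifs
    · exact W.coact_top hb
    · simp
  obtain ⟨φ, hφ⟩ := Module.Projective.exists_dual_eq_one k hb0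
  simpa [hφ] using congrArg
    (fun y => TensorProduct.rid k (FRT C) (TensorProduct.map LinearMap.id φ y)) (h₁.symm.trans h₂)

end WGF

end

theorem mainTheorem3 {k : Type u} [Field k] {V : Type v} [AddCommGroup V] [Module k V] {n : ℕ}
    (x : Module.Basis (Fin n) k V)
    (c : V ⊗[k] V ≃ₗ[k] V ⊗[k] V) (hc : IsBraiding c) (hrigid : IsRigid x c)
    {B : Type w} [Ring B] [Algebra k B] (W : WGF (FRT.coaction x (coeff x c)) B)
    (b : B) (hb : b ∈ W.gr W.top) (hb0 : b ≠ 0)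
    (ω : Fin n → B) (hω : ∀ i, ω i ∈ W.gr (W.top - 1))
    (hdual : ∀ i j, W.incl (x i) * ω j = if i = j then b else 0)
    (T : Fin n → Fin n → FRT (coeff x c))
    (hT : ∀ i, W.coact (ω i) = ∑ j, T j i ⊗ₜ[k] ω j)
    (hJ : ∀ i j, ∑ a, hayashiMap x hc W.qdet.val (T i a) * FRT.t (coeff x c) a j =
      if i = j then W.qdet.val else 0) :
    ∃ (S : Schauenburg (coeff x c) →ₗ[k] Schauenburg (coeff x c))
      (R : Schauenburg (coeff x c) ⊗[k] Schauenburg (coeff x c) →ₗ[k] k)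
      (S' : Loc W.qdet →ₗ[k] Loc W.qdet)
      (e : Schauenburg (coeff x c) ≃ₐc[k] Loc W.qdet),
      IsUniversalCQTHopf.{u, v, u, z} c.toLinearMap R (Schauenburg.coaction x (coeff x c)) ∧
      IsAntipode S ∧
      (∀ i j, S (Schauenburg.t (coeff x c) i j) = Schauenburg.u (coeff x c) i j) ∧
      IsAntipode S' ∧
      (∀ a, e (S a) = S' (e a)) ∧
      (∀ i j, e (Schauenburg.t (coeff x c) i j) = Loc.ι W.qdet (FRT.t (coeff x c) i j)) ∧
      (∀ i j, e (Schauenburg.u (coeff x c) i j) = Loc.ι W.qdet (T i j) * Loc.inv W.qdet) := by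
  have hL := W.sum_t_mul_cofactor hb hb0 hdual hT
  let g : Fin n → Fin n → Loc W.qdet := fun i j => Loc.ι W.qdet (T i j) * Loc.inv W.qdet
  have hg' : ∀ i j, ∑ a, Loc.ι W.qdet (FRT.t _ i a) * g a j = if i = j then 1 else 0 := by
    intro i j
    have := congrArg (fun y => Loc.ι W.qdet y * Loc.inv W.qdet) (hL i j)
    simp only [map_sum, map_mul, Finset.sum_mul, mul_assoc] at this
    rw [this]
    split_ifs <;> simp [Loc.ι_mul_inv]
  -- The hypothesis on `𝔍(T)`, multiplied by `D⁻¹` on the left, supplies a left inverse of `t`.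
  have hleft : ∀ i j, ∑ a, (Loc.inv W.qdet * Loc.ι W.qdet (hayashiMap x hc W.qdet.val (T i a))) *
      Loc.ι W.qdet (FRT.t _ a j) = if i = j then 1 else 0 := by
    intro i j
    have := congrArg (fun y => Loc.inv W.qdet * Loc.ι W.qdet y) (hJ i j)
    simp only [map_sum, map_mul, Finset.mul_sum, ← mul_assoc] at this
    rw [this]
    split_ifs <;> simp [Loc.inv_mul_ι]
  -- A left and a right inverse agree, that is `D⁻¹ 𝔍(T) = T D⁻¹`, so `g` is a two-sided inverse.
  have hg : ∀ i j, ∑ a, g i a * Loc.ι W.qdet (FRT.t _ a j) = if i = j then 1 else 0 := by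
    rw [← left_inv_eq_right_inv_of_sum hleft hg']
    exact hleft
  have hS := Loc.convInvAt_antipodeOp hg hg'
  have hS' := isAntipode_antiLin hS
  let e := Loc.equivSchauenburg hg hg'
  have hR := (Loc.isCoquasitriangular_conv (hc.ybCoeff x) (isInverse_coeff x c)
    (hc.symm.ybCoeff x) hS).pullback (e : Schauenburg (coeff x c) →ₐc[k] Loc W.qdet)
    (EquivLike.injective e)
  have het : ∀ i j, e (Schauenburg.t _ i j) = Loc.ι W.qdet (FRT.t _ i j) :=
    Loc.equivSchauenburg_t hg hg'
  have heu : ∀ i j, e (Schauenburg.u _ i j) = g i j := Loc.equivSchauenburg_u hg hg'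
  refine ⟨_, _, antiLin (Loc.antipodeOp hg hg'), e,
    Schauenburg.isUniversalCQTHopf (hS'.conj e) hR (fun i j a b => ?_), hS'.conj e,
    fun i j => ?_, hS', fun a => ?_, het, heu⟩
  · rw [pullbackForm_tmul]
    change pairing _ (e _ ⊗ₜ e _) = _
    rw [het, het, Loc.pairing_conv_t]
  -- The antipode of `𝓗(c)` is transported from `A(c)[D⁻¹]`, where `t_i^j` goes to `g i j`, which is
  -- the image of `u_i^j` under `e`.
  · apply EquivLike.injective e
    change e (e.symm (antiLin _ (e _))) = _
    rw [BialgEquiv.apply_symm_apply, het, heu]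
    simp
  · exact BialgEquiv.apply_symm_apply e _
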